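/- **Setting.** Let $\kappa$ be a field with algebraic closure $\overline\kappa$, and let $H_r$ be singular homology in degree $r\ge 0$ with coefficients in $\kappa$. For $f:X\to Y$ and $U\subseteq Y$ write $X_U=f^{-1}(U)$ and $X_y=f^{-1}(y)$. A continuous map $f$ is *good* if every $y\in Y$ has a contractible neighbourhood $U$ such that $X_y\subseteq X_U$ is a homotopy equivalence. It is a *fibration at* $y$ if $y$ has a neighbourhood $U$ such that $X_U\to U$ and $X_y\times U\to U$ are fibrewise homotopy equivalent over $U$. It is *tame* if it is proper, good, and a fibration at every point outside some closed discrete subset of $Y$. The points at which $f$ is not a fibration are its *critical values*. Let $X$ be compact, let $f:X\to\mathbb S^1$ be tame, and let $r\ge 0$ be such that $H_r(X_\theta)$ is finite dimensional for every angle $\theta$, where $X_\theta$ is the fibre over $e^{i\theta}$. Choose angles $0<t_1<s_1<t_2<s_2<\dots<t_m<s_m\le 2\pi$, $m\ge 1$, such that every critical value of $f$ is some $e^{is_j}$. (Such angles exist.) Put $t_{m+1}=t_1+2\pi$. There are maps $a_i:X_{t_i}\to X_{s_i}$ and $b_i:X_{t_{i+1}}\to X_{s_i}$ obtained as follows: move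 the fibre $X_t$ (with $t=t_i$, respectively $t=t_{i+1}$) by a continuous map $g:X_t\to X_\tau$, homotopic to the inclusion inside the preimage of the arc between $t$ and $\tau$. Here $\tau\neq s_i$ lies between $t$ and $s_i$, and is so close to $s_i$ that the arc between $\tau$ and $s_i$ lies in a contractible neighbourhood $U$ of $e^{is_i}$ with $X_{s_i}\subseteq X_U$ a homotopy equivalence. Then apply a homotopy inverse $X_U\to X_{s_i}$ of that inclusion. In homology the maps $a_i,b_i$ give a representation $\rho_r$ of the cyclic quiver $G_{2m}$, which has vertices $x_1,\dots,x_{2m}$ and arrows $x_{2i-1}\to x_{2i}\leftarrow x_{2i+1}$ (with $x_{2m+1}=x_1$). The spaces at the vertices are $V_{x_{2i-1}}=H_r(X_{t_i})$ and $V_{x_{2i}}=H_r(X_{s_i})$. A *bar code* is a nonempty interval $B$ with ends $s=s_i$ and $s'=s_j+2\pi k\ge s$ ($k\ge 0$ an integer), each end being open or closed. Its *spiral* is the plane curve $$\varphi\mapsto\Big(\tfrac{1}{s'-s}\varphi+\tfrac{s'-2s}{s'-s}+1\Big)(\cos\varphi,\sin\varphi),\qquad \varphi\in B,$$ which for $s=s'$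 is read as the single point $(\cos s,\sin s)$. The representation $\rho^I(B)$ has at each vertex the space with basis the points where the spiral meets the ray from the origin at the angle ($t_i$ or $s_i$) of that vertex. Its maps send such a point to the adjacent one along the spiral, or to $0$ if that point is not on the spiral. A *Jordan cell* is a pair $J=(\lambda,k)$ with $\lambda\in\overline\kappa\setminus\{0\}$ and $k\ge 1$ an integer. The representation $\rho^J(\lambda,k)$ has $\overline\kappa^{\,k}$ at each vertex and all maps the identity, except that the map $x_1\to x_2$ is the $k\times k$ Jordan block with eigenvalue $\lambda$. Finite collections (with multiplicity) $\mathcal B_r$ of bar codes and $\mathcal J_r$ of Jordan cells are the *$r$-bar codes* and *$r$-Jordan cells* of $f$ if $$\rho_r\otimes_\kappa\overline\kappa\;\cong\;\bigoplus_{B\in\mathcal B_r}\rho^I(B)\;\oplus\;\bigoplus_{J\in\mathcal J_r}\rho^J(J).$$ **Theorem.** Such collections $\mathcal B_r,\mathcal J_r$ exist, and for any such collections and every angle $\theta$, $$\dim_\kappa H_r(X_\theta)=\sum_{B\in\mathcal B_r}n_\theta(B)+\sum_{J\in\mathcal J_r}n(J).$$ Here $n_\theta(B)$ is the number of points where the spiral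 of $B$ meets the ray from the origin at angle $\theta$, and $n(J)=k$ for $J=(\lambda,k)$. -/

import Mathlib

open scoped TensorProduct Real

noncomputable section

namespace CircleMap

universe u v w w'

/-! ### Good maps, fibrations, tame maps -/

section Tame

variable {X : Type u} [TopologicalSpace X] {Y : Type v} [TopologicalSpace Y]

/-- The inclusion `f⁻¹(A) → f⁻¹(B)` for `A ⊆ B`. -/
def incl (f : X → Y) {A B : Set Y} (h : A ⊆ B) : C(f ⁻¹' A, f ⁻¹' B) where
  toFun := Set.inclusion (Set.preimage_mono h)
  continuous_toFun := continuous_inclusion (Set.preimage_mono h)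

/-- `U` is a contractible neighbourhood of `y`, and the inclusion of the fibre over `y` into
`f⁻¹(U)` is a homotopy equivalence. -/
def IsGoodNhd (f : X → Y) (y : Y) (U : Set Y) : Prop :=
  U ∈ nhds y ∧ ContractibleSpace U ∧
    ∃ (h : {y} ⊆ U) (e : ContinuousMap.HomotopyEquiv (f ⁻¹' {y}) (f ⁻¹' U)), e.toFun = incl f h

/-- A good map. -/
def IsGood (f : X → Y) : Prop := ∀ y, ∃ U, IsGoodNhd f y U

/-- `f : f⁻¹(U) → U` and the projection `f⁻¹(y) × U → U` are fibrewise homotopy equivalent. -/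
def IsFiberwiseTrivial (f : X → Y) (y : Y) (U : Set Y) : Prop :=
  ∃ (l : C(f ⁻¹' U, (f ⁻¹' {y}) × U)) (l' : C((f ⁻¹' {y}) × U, f ⁻¹' U)),
    (∀ x, ((l x).2 : Y) = f x) ∧ (∀ p, f (l' p) = p.2) ∧
    ContinuousMap.HomotopicWith (l'.comp l) (ContinuousMap.id _)
      (fun h : C(f ⁻¹' U, f ⁻¹' U) => ∀ x, f (h x) = f x) ∧
    ContinuousMap.HomotopicWith (l.comp l') (ContinuousMap.id _)
      (fun h : C((f ⁻¹' {y}) × U, (f ⁻¹' {y}) × U) => ∀ p, (h p).2 = p.2)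

/-- `f` is a fibration near `y`. For an open set `V`, the restriction `f⁻¹(V) → V` is a fibration
iff this holds at every `y ∈ V`, because fibrewise triviality over a neighbourhood of `y` restricts
to every smaller neighbourhood. -/
def IsFibrationAt (f : X → Y) (y : Y) : Prop :=
  ∃ U ∈ nhds y, IsFiberwiseTrivial f y U

/-- A tame map: proper, good, and a fibration away from a closed discrete subset. -/
structure IsTame (f : X → Y) : Prop where
  proper : IsProperMap f
  good : IsGood f
  fibration : ∃ S : Set Y, IsClosed S ∧ IsDiscrete S ∧ ∀ y ∉ S, IsFibrationAt f y

/-- The critical values: the points which prevent `f` from being a fibration. -/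
def criticalValues (f : X → Y) : Set Y := {y | ¬ IsFibrationAt f y}

end Tame

/-! ### Critical and regular angles, and the maps between the fibres over them -/

section Circle

variable {X : Type u} [TopologicalSpace X]

/-- Angles `0 < t₁ < s₁ < t₂ < s₂ < ⋯ < tₘ < sₘ ≤ 2π`, `m ≥ 1`, such that all the critical values of
`f` are among the `sᵢ`. (If `f` has no critical value, one regular angle has to be listed.) The
indices are `0, …, m - 1` instead of `1, …, m`, and are added modulo `m`. -/
structure AngleSystem (f : X → Circle) where
  m : ℕ
  [neZero : NeZero m]
  s : Fin m → ℝ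
  t : Fin m → ℝ
  t_pos : ∀ i, 0 < t i
  t_lt_s : ∀ i, t i < s i
  s_lt_t : ∀ i j, i < j → s i < t j
  s_le : ∀ i, s i ≤ 2 * π
  critical_subset : criticalValues f ⊆ Set.range (fun i => Circle.exp (s i))

attribute [instance] AngleSystem.neZero

/-- The lift of the angle of `t (i + 1)` which lies above `s i`: it is `t (i + 1)`, or `t 0 + 2π`
when `i` is the last index. -/
def AngleSystem.tNext {f : X → Circle} (S : AngleSystem f) (i : Fin S.m) : ℝ :=
  S.t (i + 1) + if i + 1 = 0 then 2 * π else 0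

/-- The continuous map `a` from the fibre over `y = exp (i t)` to the fibre over `z = exp (i s)` is
obtained (uniquely up to homotopy) as follows. The fibre over `y` is first moved, along the interval
between `t` and `τ`, to a fibre over an angle `τ ≠ s` such that the interval between `τ` and `s` lies
in a contractible neighbourhood `U` of `z` with `f⁻¹(z) ⊆ f⁻¹(U)` a homotopy equivalence; this is
`g`. Then a homotopy inverse of `f⁻¹(z) ⊆ f⁻¹(U)`, restricted to the fibre over `τ`, is applied. -/
def IsFiberMap (f : X → Circle) (t s : ℝ) {y z : Circle} (a : C(f ⁻¹' {y}, f ⁻¹' {z})) : Prop :=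
  y = Circle.exp t ∧ z = Circle.exp s ∧
  ∃ τ ∈ Set.uIcc t s, τ ≠ s ∧
  ∃ U : Set Circle, IsGoodNhd f z U ∧ Circle.exp '' Set.uIcc τ s ⊆ U ∧
  ∃ (h₁ : {y} ⊆ Circle.exp '' Set.uIcc t τ)
    (h₂ : {Circle.exp τ} ⊆ Circle.exp '' Set.uIcc t τ)
    (h₃ : {Circle.exp τ} ⊆ U) (h₄ : {z} ⊆ U)
    (g : C(f ⁻¹' {y}, f ⁻¹' {Circle.exp τ})),
    ContinuousMap.Homotopic ((incl f h₂).comp g) (incl f h₁) ∧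
    ContinuousMap.Homotopic ((incl f h₄).comp a) ((incl f h₃).comp g)

end Circle

/-! ### Singular homology with coefficients in a field -/

section Homology

variable (κ : Type v) [Field κ]

/-- `H_r(Z)`, singular homology with coefficients in the field `κ`. -/
def homology (r : ℕ) (Z : Type u) [TopologicalSpace Z] : ModuleCat.{max u v} κ :=
  ((AlgebraicTopology.singularHomologyFunctor.{u} (ModuleCat.{max u v} κ) r).obj
    (ModuleCat.of κ (ULift.{u} κ))).obj (TopCat.of Z)

/-- The linear map induced in homology by a continuous map. -/
def homologyMap (r : ℕ) {Z Z' : Type u} [TopologicalSpace Z] [TopologicalSpace Z'] (g : C(Z, Z')) :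
    homology κ r Z →ₗ[κ] homology κ r Z' :=
  (((AlgebraicTopology.singularHomologyFunctor.{u} (ModuleCat.{max u v} κ) r).obj
    (ModuleCat.of κ (ULift.{u} κ))).map (TopCat.ofHom g)).hom

end Homology

/-! ### Representations of the cyclic quiver `G_{2m}` -/

/-- A representation of `G_{2m}`: the odd vertices carry the `V i`, the even ones the `W i`, with
forward maps `α i : V i → W i` and backward maps `β i : V (i + 1) → W i`, indices modulo `m`. -/
structure QuiverRep (K : Type v) [Field K] (m : ℕ) [NeZero m] where
  V : Fin m → Type w
  W : Fin m → Type w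
  [acgV : ∀ i, AddCommGroup (V i)]
  [acgW : ∀ i, AddCommGroup (W i)]
  [modV : ∀ i, Module K (V i)]
  [modW : ∀ i, Module K (W i)]
  α : ∀ i, V i →ₗ[K] W i
  β : ∀ i, V (i + 1) →ₗ[K] W i

attribute [instance] QuiverRep.acgV QuiverRep.acgW QuiverRep.modV QuiverRep.modW

namespace QuiverRep

variable {K : Type v} [Field K] {m : ℕ} [NeZero m]

/-- Two representations are isomorphic. -/
def IsIsomorphic (R : QuiverRep.{v, w} K m) (R' : QuiverRep.{v, w'} K m) : Prop :=
  ∃ (eV : ∀ i, R.V i ≃ₗ[K] R'.V i) (eW : ∀ i, R.W i ≃ₗ[K] R'.W i),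
    (∀ i x, eW i (R.α i x) = R'.α i (eV i x)) ∧
    (∀ i x, eW i (R.β i x) = R'.β i (eV (i + 1) x))

/-- The direct sum of a finite family of representations. -/
def directSum {ι : Type} [Finite ι] (R : ι → QuiverRep.{v, w} K m) : QuiverRep.{v, w} K m where
  V i := ∀ j, (R j).V i
  W i := ∀ j, (R j).W i
  α i := LinearMap.piMap fun j => (R j).α i
  β i := LinearMap.piMap fun j => (R j).β i

/-- Extension of scalars. -/
def baseChange (L : Type v) [Field L] [Algebra K L] (R : QuiverRep.{v, w} K m) :
    QuiverRep.{v, max v w} L m where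
  V i := L ⊗[K] R.V i
  W i := L ⊗[K] R.W i
  α i := (R.α i).baseChange L
  β i := (R.β i).baseChange L

end QuiverRep

/-! ### Bar codes and their spirals -/

/-- A bar code: a nonempty bounded interval with left end `s ∈ (0, 2π]` and right end `s' ≥ s`,
each end being open or closed. -/
structure BarCode where
  left : ℝ
  right : ℝ
  leftClosed : Bool
  rightClosed : Bool
  left_pos : 0 < left
  left_le : left ≤ 2 * π
  nonempty : left < right ∨ (left = right ∧ leftClosed = true ∧ rightClosed = true)

namespace BarCode

/-- The interval of a bar code, as a set of real numbers. -/
def carrier (B : BarCode) : Set ℝ :=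
  {φ | B.left ≤ φ ∧ φ ≤ B.right ∧ (φ = B.left → B.leftClosed = true) ∧
    (φ = B.right → B.rightClosed = true)}

/-- The radius of the point with parameter `φ` on the spiral. For `s = s'` the fractions are read as
`0`, and the spiral is a single point in the direction `s`. -/
def radius (B : BarCode) (φ : ℝ) : ℝ :=
  1 / (B.right - B.left) * φ + (B.right - 2 * B.left) / (B.right - B.left) + 1

/-- The spiral of a bar code, a curve in the plane. -/
def spiral (B : BarCode) : Set (ℝ × ℝ) :=
  (fun φ : ℝ => (B.radius φ * Real.cos φ, B.radius φ * Real.sin φ)) '' B.carrier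

/-- The ray from the origin which makes the angle `θ` with the `x`-axis. -/
def ray (θ : ℝ) : Set (ℝ × ℝ) :=
  {z | ∃ c : ℝ, 0 ≤ c ∧ z = (c * Real.cos θ, c * Real.sin θ)}

/-- `n_θ(B)`: the number of points where the spiral of `B` meets the ray at angle `θ`. -/
def rayCount (B : BarCode) (θ : ℝ) : ℕ := (B.spiral ∩ ray θ).ncard

/-- The parameters of the points where the spiral meets the ray at angle `x`. -/
def hits (B : BarCode) (x : ℝ) : Set ℝ :=
  {φ | φ ∈ B.carrier ∧ ∃ n : ℤ, φ = x + 2 * π * n}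

open Classical in
/-- The linear map which sends the basis vector of the intersection point with parameter `φ` to the
basis vector of the intersection point with parameter `φ + d`, or to zero if that point is not on
the spiral. -/
def shift (K : Type v) [Field K] (B : BarCode) (x y d : ℝ) :
    (B.hits x →₀ K) →ₗ[K] (B.hits y →₀ K) :=
  Finsupp.linearCombination K fun φ : B.hits x =>
    if h : (φ : ℝ) + d ∈ B.hits y then Finsupp.single ⟨(φ : ℝ) + d, h⟩ (1 : K) else 0

end BarCode

/-! ### Jordan cells -/

/-- A Jordan cell `(λ, k)` with `λ ≠ 0` in the algebraic closure of `κ` and `k > 0`. -/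
structure JordanCell (κ : Type v) [Field κ] where
  eig : AlgebraicClosure κ
  size : ℕ
  eig_ne_zero : eig ≠ 0
  size_pos : 0 < size

/-- The matrix of a Jordan cell: `λ` on the diagonal and `1` just above it. -/
def JordanCell.matrix {κ : Type v} [Field κ] (J : JordanCell κ) :
    Matrix (Fin J.size) (Fin J.size) (AlgebraicClosure κ) :=
  Matrix.of fun i j => if i = j then J.eig else if (i : ℕ) + 1 = j then 1 else 0

/-- The representation `ρ^J(λ, k)`: all the maps are the identity, except that `α 0` is given by the
Jordan matrix. -/
def JordanCell.rep {κ : Type v} [Field κ] (J : JordanCell κ) (m : ℕ) [NeZero m] :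
    QuiverRep.{v, v} (AlgebraicClosure κ) m where
  V _ := Fin J.size → AlgebraicClosure κ
  W _ := Fin J.size → AlgebraicClosure κ
  α i := if i = 0 then Matrix.toLin' J.matrix else LinearMap.id
  β _ := LinearMap.id

/-! ### The `r`-invariants of a circle valued map -/

section Invariants

variable {X : Type u} [TopologicalSpace X] {f : X → Circle}

/-- The ends of the bar code `B` are critical angles: `B` is an interval between some `s i` and some
`s j + 2 k π`, where `k ≥ 0`. -/
def AngleSystem.EndsAt (S : AngleSystem f) (B : BarCode) : Prop :=
  ∃ (i j : Fin S.m) (k : ℕ), B.left = S.s i ∧ B.right = S.s j + 2 * π * k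

/-- The representation `ρ^I` of a bar code: each vertex carries the vector space with basis the
points where its ray meets the spiral, and the maps send each such point to the adjacent one along
the spiral. -/
def AngleSystem.barRep (S : AngleSystem f) (K : Type v) [Field K] (B : BarCode) :
    QuiverRep.{v, v} K S.m where
  V i := B.hits (S.t i) →₀ K
  W i := B.hits (S.s i) →₀ K
  α i := B.shift K (S.t i) (S.s i) (S.s i - S.t i)
  β i := B.shift K (S.t (i + 1)) (S.s i) (S.s i - S.tNext i)

/-- The representation `ρ_r` of `G_{2m}`: the homology of the fibres over the angles `t i` and `s i`,
with the linear maps induced by continuous maps between these fibres. -/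
def AngleSystem.homologyRep (S : AngleSystem f) (κ : Type v) [Field κ] (r : ℕ)
    (a : ∀ i, C(f ⁻¹' {Circle.exp (S.t i)}, f ⁻¹' {Circle.exp (S.s i)}))
    (b : ∀ i, C(f ⁻¹' {Circle.exp (S.t (i + 1))}, f ⁻¹' {Circle.exp (S.s i)})) :
    QuiverRep.{v, max u v} κ S.m where
  V i := homology κ r (f ⁻¹' {Circle.exp (S.t i)})
  W i := homology κ r (f ⁻¹' {Circle.exp (S.s i)})
  α i := homologyMap κ r (a i)
  β i := homologyMap κ r (b i)

/-- `B` and `J` list (with multiplicity) the `r`-bar codes and the `r`-Jordan cells of `f`: after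
extension of scalars to the algebraic closure of `κ`, the representation `ρ_r` is the direct sum of
the indecomposable representations of the bar codes in `B` and of the Jordan cells in `J`. -/
def AngleSystem.IsInvariants (S : AngleSystem f) (κ : Type v) [Field κ] (r : ℕ) {p q : ℕ}
    (B : Fin p → BarCode) (J : Fin q → JordanCell κ) : Prop :=
  (∀ l, S.EndsAt (B l)) ∧
  ∃ (a : ∀ i, C(f ⁻¹' {Circle.exp (S.t i)}, f ⁻¹' {Circle.exp (S.s i)}))
    (b : ∀ i, C(f ⁻¹' {Circle.exp (S.t (i + 1))}, f ⁻¹' {Circle.exp (S.s i)})),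
    (∀ i, IsFiberMap f (S.t i) (S.s i) (a i)) ∧
    (∀ i, IsFiberMap f (S.tNext i) (S.s i) (b i)) ∧
    ((S.homologyRep κ r a b).baseChange (AlgebraicClosure κ)).IsIsomorphic
      (QuiverRep.directSum (ι := Fin p ⊕ Fin q)
        (Sum.elim (fun l => S.barRep (AlgebraicClosure κ) (B l)) (fun l => (J l).rep S.m)))

end Invariants

end CircleMap

end

open scoped TensorProduct Real

noncomputable section

namespace CircleMap

universe u v w w' w''

/-! ### Linear relations -/

namespace LinRel

open Module

variable {K E : Type*} [Field K] [AddCommGroup E] [Module K E]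

/-! The dimension formula is a count at the vertices of the quiver. Extension of scalars preserves
dimension, so the decomposition gives the formula at the angles `t i` and `s i`. Any other angle
lies in a gap between consecutive lifts of the `s i`. Over a gap `f` is a fibration, so the
dimension of the homology is constant there (`finrank_homology_eq_of_mem_gap`). No bar code ends
inside a gap, so the counts are constant as well (`card_hits_eq_of_mem_gap`). Both sides can thus be
compared at the lift of a `t` in the same gap. The passage from the planar spiral to parameters
modulo `2π` is `rayCount_eq`.

Existence is the decomposition of finite dimensional representations of the cyclic quiver over an
algebraically closed field. One summand is split off at a time, by induction on the total dimension
(`exists_summand`).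

On the sum `E` of all the vertex spaces, the maps `α` and the inverses of the `β` form one linear
relation `C`, which moves each vertex one step along the line covering the quiver. If some `β` is
not injective or some `α` is not surjective, then `C 0 ≠ 0` or `C E ≠ E`. The pair `B ≤ A` is taken
to be `0 ≤ C 0` or `C E ≤ E`, and both are pushed forward by powers of `C`. The images are
interlaced, so by finite dimension the quotient `A / B` must at some step meet the kernel of `C` or
fail to be covered by its domain. This yields a chain of vectors and a dual chain of functionals
with a unitriangular matrix of pairings (`exists_string`). The vectors map the representation of a
bar code into `R`, the functionals map `R` back, and the composite is invertible, so the bar code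
splits off (`exists_isIsomorphic_barRep_prod`).

Otherwise a dimension count makes every map an isomorphism, and the representation amounts to its
monodromy `T` around the cycle. For an eigenvalue `μ`, the same string lemma applied to the graph of
`T - μ` splits off a Jordan block (`exists_jordan_summand`). -/

/-- The image of a subspace under a linear relation. -/
def image (C : Submodule K (E × E)) (A : Submodule K E) : Submodule K E :=
  (C ⊓ A.comap (LinearMap.fst K E E)).map (LinearMap.snd K E E)

variable {C : Submodule K (E × E)}

theorem mem_image {A : Submodule K E} {y : E} : y ∈ image C A ↔ ∃ x ∈ A, (x, y) ∈ C := by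
  constructor
  · rintro ⟨⟨x, y⟩, ⟨h₁, h₂⟩, rfl⟩
    exact ⟨x, h₂, h₁⟩
  · rintro ⟨x, hx, h⟩
    exact ⟨(x, y), ⟨h, hx⟩, rfl⟩

theorem image_mono {A B : Submodule K E} (h : A ≤ B) : image C A ≤ image C B := by
  intro y hy
  obtain ⟨x, hx, hxy⟩ := mem_image.1 hy
  exact mem_image.2 ⟨x, h hx, hxy⟩

/-- The image of a subspace under the `n`-th power of a linear relation. -/
def iter (C : Submodule K (E × E)) (A : Submodule K E) : ℕ → Submodule K E
  | 0 => A
  | n + 1 => image C (iter C A n)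

theorem iter_mono {A B : Submodule K E} (h : A ≤ B) (n : ℕ) : iter C A n ≤ iter C B n := by
  induction n with
  | zero => exact h
  | succ n ih => exact image_mono ih

theorem exists_chain {A : Submodule K E} (n : ℕ) {v : E} (hv : v ∈ iter C A n) :
    ∃ w : ℕ → E, w 0 ∈ A ∧ w n = v ∧ ∀ k < n, (w k, w (k + 1)) ∈ C := by
  induction n generalizing v with
  | zero => exact ⟨fun _ => v, hv, rfl, by simp⟩
  | succ n ih =>
    obtain ⟨u, hu, huv⟩ := mem_image.1 hv
    obtain ⟨w, h₀, h₁, h₂⟩ := ih hu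
    refine ⟨fun k => if k ≤ n then w k else v, by simpa using h₀, by simp, fun k hk => ?_⟩
    rcases Nat.lt_succ_iff_lt_or_eq.1 hk with h | rfl
    · simpa [h.le, Nat.succ_le_of_lt h] using h₂ k h
    · simpa [h₁] using huv

theorem mem_iter_of_chain {A : Submodule K E} {n : ℕ} {w : ℕ → E} (h₀ : w 0 ∈ A)
    (h : ∀ k < n, (w k, w (k + 1)) ∈ C) {k : ℕ} (hk : k ≤ n) : w k ∈ iter C A k := by
  induction k with
  | zero => exact h₀
  | succ k ih => exact mem_image.2 ⟨w k, ih (by omega), h k (by omega)⟩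

/-- A functional which kills the image of `B` is transported backwards along the relation. -/
theorem exists_dual_step {B : Submodule K E} {φ : Dual K E} (hφ : ∀ y ∈ image C B, φ y = 0) :
    ∃ ψ : Dual K E, (∀ x ∈ B, ψ x = 0) ∧ ∀ p ∈ C, ψ p.1 = φ p.2 := by
  -- All the requirements on `ψ` together say `ψ ∘ Q = χ`. This is solvable exactly when `χ` kills
  -- `ker Q`, and there the hypothesis on `φ` applies.
  let Q : (C × B) →ₗ[K] E :=
    ((LinearMap.fst K E E).comp C.subtype).coprod B.subtype
  let χ : Dual K (C × B) :=
    (φ.comp ((LinearMap.snd K E E).comp C.subtype)).coprod 0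
  have hχ : χ ∈ LinearMap.range Q.dualMap := by
    rw [LinearMap.range_dualMap_eq_dualAnnihilator_ker, Submodule.mem_dualAnnihilator]
    rintro ⟨⟨⟨x, y⟩, hp⟩, ⟨b, hb⟩⟩ hk
    have hk' : x + b = 0 := by simpa [Q] using hk
    have hx : x = -b := eq_neg_of_add_eq_zero_left hk'
    have : y ∈ image C B := mem_image.2 ⟨x, hx ▸ B.neg_mem hb, hp⟩
    simpa [χ] using hφ y this
  obtain ⟨ψ, hψ⟩ := hχ
  refine ⟨ψ, fun x hx => ?_, fun p hp => ?_⟩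
  · have := LinearMap.congr_fun hψ (0, ⟨x, hx⟩)
    simpa [Q, χ] using this
  · have := LinearMap.congr_fun hψ (⟨p, hp⟩, 0)
    simpa [Q, χ] using this

/-- The dual step is repeated from the last index down to `0`. The resulting pairings are constant
along chains of `C`. -/
theorem exists_dual_chain {B : Submodule K E} (n : ℕ) {φ : Dual K E}
    (hφ : ∀ y ∈ iter C B n, φ y = 0) :
    ∃ ψ : ℕ → Dual K E, ψ n = φ ∧ (∀ k ≤ n, ∀ x ∈ iter C B k, ψ k x = 0) ∧
      ∀ k < n, ∀ p ∈ C, ψ k p.1 = ψ (k + 1) p.2 := by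
  induction n generalizing φ with
  | zero => exact ⟨fun _ => φ, rfl, fun k hk => by simpa [Nat.le_zero.1 hk] using hφ, by simp⟩
  | succ n ih =>
    obtain ⟨χ, h₁, h₂⟩ := exists_dual_step hφ
    obtain ⟨ψ, h₃, h₄, h₅⟩ := ih h₁
    refine ⟨fun k => if k ≤ n then ψ k else φ, by simp, fun k hk x hx => ?_, fun k hk p hp => ?_⟩
    · rcases Nat.le_succ_iff.1 hk with h | rfl
      · simpa [h] using h₄ k h x hx
      · simpa using hφ x hx
    · rcases Nat.lt_succ_iff_lt_or_eq.1 hk with h | rfl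
      · simpa [h.le, Nat.succ_le_of_lt h] using h₅ k h p hp
      · simpa [h₃] using h₂ p hp

/-- If neither the kernel nor the cokernel of the relation `C` meets `A / B`, then the quotient of
the images of `A` and `B` is nonzero with `A / B`. -/
theorem not_image_le {A B : Submodule K E} (hBA : B ≤ A) (hAB : ¬ A ≤ B)
    (hker : ∀ v ∈ A, (v, 0) ∈ C → v ∈ B)
    (hdom : A ≤ B ⊔ C.map (LinearMap.fst K E E)) : ¬ image C A ≤ image C B := by
  intro hle
  refine hAB fun v hv => ?_
  -- Modulo `B` the vector lies in the domain of `C`. If its image `y` also came from some `b'` in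
  -- `B`, then `x - b'` would be in the kernel, hence in `B`.
  obtain ⟨b, hb, _, ⟨⟨x, y⟩, hxy, rfl⟩, rfl⟩ := Submodule.mem_sup.1 (hdom hv)
  have hx : x ∈ A := by
    have := A.sub_mem hv (hBA hb)
    simpa using this
  obtain ⟨b', hb', hby⟩ := mem_image.1 (hle (mem_image.2 ⟨x, hx, hxy⟩))
  have h0 : (x - b', (0 : E)) ∈ C := by simpa using C.sub_mem hxy hby
  have := hker _ (A.sub_mem hx (hBA hb')) h0
  have hxB : x ∈ B := by simpa using B.add_mem this hb'
  exact B.add_mem hb hxB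

/-- The quotient of two subspaces whose iterated images are interlaced meets, after finitely many
steps, the kernel or the cokernel of the relation. -/
theorem exists_drop [FiniteDimensional K E] {A B : Submodule K E} (hBA : B ≤ A) (hAB : ¬ A ≤ B)
    (hchain : (∀ k k', k < k' → iter C A k ≤ iter C B k') ∨
      ∀ k k', k' < k → iter C A k ≤ iter C B k') :
    ∃ n, (∃ v ∈ iter C A n, (v, 0) ∈ C ∧ v ∉ iter C B n) ∨
      ¬ iter C A n ≤ iter C B n ⊔ C.map (LinearMap.fst K E E) := by
  -- If the quotient survived every step, the interlacing would make the iterates of `A` an infinite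
  -- strictly monotone sequence of subspaces.
  by_contra! hno
  have hne : ∀ n, ¬ iter C A n ≤ iter C B n := by
    intro n
    induction n with
    | zero => exact hAB
    | succ n ih => exact not_image_le (iter_mono hBA n) ih (hno n).1 (hno n).2
  have hlt : ∀ n, iter C B n < iter C A n := fun n =>
    lt_of_le_not_ge (iter_mono hBA n) (hne n)
  rcases hchain with h | h
  · have hs : StrictMono fun n => iter C A n := strictMono_nat_of_lt_succ fun n =>
      (h n (n + 1) (by omega)).trans_lt (hlt _)
    exact WellFounded.not_rel_apply_succ (r := (· > ·)) (fun n => iter C A n) |>.elim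
      fun n hn => hn (hs n.lt_succ_self)
  · have hs : StrictAnti fun n => iter C A n := strictAnti_nat_of_succ_lt fun n =>
      (h (n + 1) n (by omega)).trans_lt (hlt _)
    exact WellFounded.not_rel_apply_succ (r := (· < ·)) (fun n => iter C A n) |>.elim
      fun n hn => hn (hs n.lt_succ_self)

/-- The left side is the `(k + 1)`-st iterate of `⊥`, and the iterates of `⊥` increase. The iterates
of `⊤` decrease in the same way. -/
theorem iter_le_iter_of_kernel {k k' : ℕ} (h : k < k') :
    iter C (image C ⊥) k ≤ iter C ⊥ k' := by
  induction k generalizing k' with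
  | zero =>
    obtain ⟨l, rfl⟩ := Nat.exists_eq_succ_of_ne_zero h.ne'
    exact image_mono bot_le
  | succ k ih =>
    obtain ⟨l, rfl⟩ := Nat.exists_eq_succ_of_ne_zero (Nat.ne_zero_of_lt h)
    exact image_mono (ih (by omega))

theorem iter_le_iter_of_range {k k' : ℕ} (h : k' < k) :
    iter C ⊤ k ≤ iter C (image C ⊤) k' := by
  induction k' generalizing k with
  | zero =>
    obtain ⟨l, rfl⟩ := Nat.exists_eq_succ_of_ne_zero h.ne'
    exact image_mono le_top
  | succ k' ih =>
    obtain ⟨l, rfl⟩ := Nat.exists_eq_succ_of_ne_zero (Nat.ne_zero_of_lt h)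
    exact image_mono (ih (by omega))

/-- A linear relation which is homogeneous with respect to the projections `P`, and whose inverse is
not single valued or not everywhere defined, contains a string together with a dual string, such
that the matrix of pairings is triangular. -/
theorem exists_string [FiniteDimensional K E] (N : ℤ) (P : ℤ → E →ₗ[K] E)
    (hP : ∀ L, ∀ p ∈ C, (P L p.1, P (L + 1) p.2) ∈ C)
    (hsum : ∀ (ψ : Dual K E) (u : E), ψ u ≠ 0 → ∀ n : ℤ, ∃ L, 1 ≤ L ∧ L ≤ N ∧
      ψ (P (L + n) u) ≠ 0)
    (h : image C ⊥ ≠ ⊥ ∨ image C ⊤ ≠ ⊤) :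
    ∃ (L : ℤ) (n : ℕ) (v : ℕ → E) (ψ : ℕ → Dual K E), 1 ≤ L ∧ L ≤ N ∧
      (∀ k < n, (v k, v (k + 1)) ∈ C) ∧
      (∀ k < n, ∀ p ∈ C, ψ k p.1 = ψ (k + 1) p.2) ∧
      (∀ k ≤ n, ψ k (P (L + k) (v k)) = 1) ∧
      ((0, v 0) ∈ C ∨ ∀ p ∈ C, ψ 0 p.2 = 0) ∧
      ((v n, 0) ∈ C ∨ ∀ p ∈ C, ψ n p.1 = 0) ∧
      ((∀ k k', k < k' → k' ≤ n → ψ k' (P (L + k) (v k)) = 0) ∨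
        ∀ k k', k' < k → k ≤ n → ψ k' (P (L + k) (v k)) = 0) := by
  obtain ⟨A, B, hBA, hAB, hhom, hstart, hchain⟩ : ∃ A B : Submodule K E, B ≤ A ∧ ¬ A ≤ B ∧
      (∀ v ∈ A, ∀ L, P L v ∈ A) ∧
      ((∀ v ∈ A, (0, v) ∈ C) ∨ ∀ p ∈ C, p.2 ∈ B) ∧
      ((∀ k k', k < k' → iter C A k ≤ iter C B k') ∨
        ∀ k k', k' < k → iter C A k ≤ iter C B k') := by
    -- For `A = C 0` every starting vector is related to `0` on the left. For `B = C E` every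
    -- functional killing `B` kills the range of `C`. These are the two possible behaviours at the
    -- start of the string.
    rcases h with h | h
    · refine ⟨image C ⊥, ⊥, bot_le, by simpa using h, fun v hv L => ?_, Or.inl fun v hv => ?_,
        Or.inl fun _ _ => iter_le_iter_of_kernel⟩
      · obtain ⟨x, hx, hxv⟩ := mem_image.1 hv
        refine mem_image.2 ⟨P (L - 1) x, by simp_all, ?_⟩
        simpa using hP (L - 1) _ hxv
      · obtain ⟨x, hx, hxv⟩ := mem_image.1 hv
        rwa [(Submodule.mem_bot K).1 hx] at hxv
    · exact ⟨⊤, image C ⊤, le_top, by simpa using h, fun _ _ _ => trivial,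
        Or.inr fun p hp => mem_image.2 ⟨p.1, trivial, hp⟩,
        Or.inr fun _ _ => iter_le_iter_of_range⟩
  obtain ⟨n, φ, w, hw, hφ, hφw, hend⟩ : ∃ (n : ℕ) (φ : Dual K E), ∃ w ∈ iter C A n,
      (∀ y ∈ iter C B n, φ y = 0) ∧ φ w ≠ 0 ∧ ((w, 0) ∈ C ∨ ∀ p ∈ C, φ p.1 = 0) := by
    -- The end of the string: either the last vector is in the kernel, or the last functional can be
    -- chosen to kill the domain.
    obtain ⟨n, ⟨w, hw, hw0, hwB⟩ | hn⟩ := exists_drop hBA hAB hchain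
    · obtain ⟨φ, h₁, h₂⟩ := Submodule.exists_le_ker_of_notMem hwB
      exact ⟨n, φ, w, hw, fun y hy => h₂ hy, h₁, Or.inl hw0⟩
    · obtain ⟨w, hw, hwB⟩ := SetLike.not_le_iff_exists.1 hn
      obtain ⟨φ, h₁, h₂⟩ := Submodule.exists_le_ker_of_notMem hwB
      exact ⟨n, φ, w, hw, fun y hy => h₂ (Submodule.mem_sup_left hy), h₁,
        Or.inr fun p hp => h₂ (Submodule.mem_sup_right ⟨p, hp, rfl⟩)⟩
  -- `w` need not be homogeneous. Some homogeneous component still pairs nontrivially with `φ`; this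
  -- fixes the position, and `φ` is rescaled so that the pairing is `1`.
  obtain ⟨L, hL₁, hL₂, hL⟩ := hsum φ w hφw n
  obtain ⟨v, hv₀, hvn, hv⟩ := exists_chain n hw
  set a := φ (P (L + n) w)
  obtain ⟨ψ, hψn, hψB, hψ⟩ := exists_dual_chain n (φ := a⁻¹ • φ) (fun y hy => by simp [hφ y hy])
  have hmem : ∀ k ≤ n, P (L + k) (v k) ∈ iter C A k := by
    intro k hk
    refine mem_iter_of_chain (w := fun k : ℕ => P (L + k) (v k)) (n := n)
      (by simpa using hhom _ hv₀ L) (fun k hk => ?_) hk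
    have := hP (L + k) _ (hv k hk)
    simpa [add_assoc] using this
  -- The projected chain is again a chain of `C`, so the value `1` at the last index propagates back
  -- to the first.
  have hpair : ∀ k ≤ n, ψ k (P (L + k) (v k)) = 1 := by
    intro k hk
    induction hk using Nat.decreasingInduction with
    | self => simp [hψn, hvn, a, inv_mul_cancel₀ hL]
    | of_succ k hk ih =>
      have := hψ k hk _ (hP (L + k) _ (hv k hk))
      rw [this, ← ih]
      simp [add_assoc]
  refine ⟨L, n, v, ψ, hL₁, hL₂, hv, hψ, hpair, ?_, ?_, ?_⟩
  · exact hstart.imp (fun h => h _ hv₀) fun h p hp => hψB 0 n.zero_le _ (h p hp)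
  · refine hend.imp (fun h => by rwa [hvn]) fun h p hp => by simp [hψn, h p hp]
  -- Triangularity is the interlacing: the `k`-th projected vector lies in the `k'`-th iterate of
  -- `B`, which `ψ k'` kills.
  · exact hchain.imp (fun h k k' hkk hk => hψB k' hk _ (h k k' hkk (hmem k (by omega))))
      fun h k k' hkk hk => hψB k' (by omega) _ (h k k' hkk (hmem k hk))

end LinRel

/-! ### Strings in a representation of the cyclic quiver -/

namespace QuiverRep

open Module

/-- The position, on the infinite line which covers the cyclic quiver, of the `n`-th lift of the
odd vertex with index `i`. The next position is that of the `n`-th lift of the even vertex. -/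
def pos {m : ℕ} (i : Fin m) (n : ℤ) : ℤ := 2 * ((i : ℕ) + m * n)

/-- `1` if the passage from the index `i` to the index `i + 1` completes a turn. -/
def carry {m : ℕ} [NeZero m] (i : Fin m) : ℤ := if i + 1 = 0 then 1 else 0

/-! ### Positions on the infinite line covering the quiver -/

section Pos

variable {m : ℕ}

theorem pos_add_one_ne (i j : Fin m) (n n' : ℤ) : pos i n + 1 ≠ pos j n' := by
  unfold pos; omega

theorem pos_add_turns (i : Fin m) (n k : ℤ) : pos i (n + k) = pos i n + 2 * m * k := by
  unfold pos; ring

variable [NeZero m]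

theorem val_add_one_add_carry (i : Fin m) : (((i + 1 : Fin m) : ℕ) : ℤ) + m * carry i = (i : ℕ) + 1 := by
  obtain ⟨k, rfl⟩ := Nat.exists_eq_succ_of_ne_zero (NeZero.ne m)
  unfold carry
  rcases (Fin.le_last i).eq_or_lt with rfl | h
  · simp
  · have h₁ := Fin.val_add_one_of_lt h
    have h₂ : i + 1 ≠ 0 := fun h₂ => by simp [h₂] at h₁
    rw [if_neg h₂, h₁]
    simp

theorem pos_succ (i : Fin m) (n : ℤ) : pos (i + 1) (n + carry i) = pos i n + 2 := by
  have := val_add_one_add_carry i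
  unfold pos
  linear_combination 2 * this

theorem pos_eq_iff {i j : Fin m} {n n' : ℤ} : pos i n = pos j n' ↔ i = j ∧ n = n' := by
  refine ⟨fun h => ?_, fun ⟨h, h'⟩ => by rw [h, h']⟩
  have h' : ((i : ℕ) : ℤ) + m * n = (j : ℕ) + m * n' := by unfold pos at h; omega
  have hm : (0 : ℤ) < m := by exact_mod_cast NeZero.pos m
  have hi : ((i : ℕ) : ℤ) < m := by exact_mod_cast i.2
  have hj : ((j : ℕ) : ℤ) < m := by exact_mod_cast j.2
  have e₁ : (((i : ℕ) : ℤ) + m * n) / m = n := by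
    rw [Int.add_mul_ediv_left _ _ hm.ne', Int.ediv_eq_zero_of_lt (by positivity) hi, zero_add]
  have e₂ : (((j : ℕ) : ℤ) + m * n') / m = n' := by
    rw [Int.add_mul_ediv_left _ _ hm.ne', Int.ediv_eq_zero_of_lt (by positivity) hj, zero_add]
  have hn : n = n' := by rw [← e₁, ← e₂, h']
  subst hn
  exact ⟨Fin.ext (by exact_mod_cast add_right_cancel h'), rfl⟩

theorem exists_pos_iff {L : ℤ} (i : Fin m) :
    (∃ n, L = pos (i + 1) n) ↔ ∃ n, L = pos i n + 2 := by
  constructor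
  · rintro ⟨n, rfl⟩
    exact ⟨n - carry i, by rw [← pos_succ, sub_add_cancel]⟩
  · rintro ⟨n, rfl⟩
    exact ⟨n + carry i, (pos_succ i n).symm⟩

theorem pos_strictMono (i : Fin m) : StrictMono (pos i) := by
  intro n n' h
  have hm : (0 : ℤ) < m := by exact_mod_cast NeZero.pos m
  unfold pos
  have := mul_lt_mul_of_pos_left h hm
  omega

/-- Every residue class modulo `2 m` meets a window of length `2 m` exactly once. -/
theorem existsUnique_window (r : ℤ) :
    ∃! L : ℤ, (1 ≤ L ∧ L ≤ 2 * m) ∧ ∃ k : ℤ, L = r + 2 * m * k := by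
  have hm : (0 : ℤ) < 2 * m := by
    have : (0 : ℤ) < m := by exact_mod_cast NeZero.pos m
    omega
  have h₁ := Int.emod_add_mul_ediv (r - 1) (2 * m)
  have h₂ := Int.emod_nonneg (r - 1) hm.ne'
  have h₃ := Int.emod_lt_of_pos (r - 1) hm
  refine ⟨(r - 1) % (2 * m) + 1, ⟨⟨by omega, by omega⟩, -((r - 1) / (2 * m)), by
    linear_combination h₁⟩, ?_⟩
  rintro L ⟨⟨h₄, h₅⟩, k, rfl⟩
  have : (r - 1) % (2 * m) = (r + 2 * m * k - 1) % (2 * m) := by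
    rw [show r + 2 * m * k - 1 = r - 1 + 2 * m * k by ring, Int.add_mul_emod_self_left]
  rw [this, Int.emod_eq_of_lt (by omega) (by omega)]
  ring

end Pos

variable {K : Type v} [Field K] {m : ℕ} [NeZero m]

/-- A string of vectors along a part of the line which covers the cyclic quiver, together with a
dual string of functionals. The part consists of the lifts `n` of the odd vertex `i` with `p i n`,
and of the even vertex `i` with `q i n`. -/
structure Strand (R : QuiverRep.{v, w} K m) (p q : Fin m → ℤ → Prop) where
  x : ∀ i, ℤ → R.V i
  y : ∀ i, ℤ → R.W i
  ξ : ∀ i, ℤ → Dual K (R.V i)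
  η : ∀ i, ℤ → Dual K (R.W i)
  -- With `y` and `ξ` zero off the part, the equations for `α` and `β` below also encode the
  -- vanishing conditions at its two ends.
  y_eq_zero : ∀ i n, ¬ q i n → y i n = 0
  ξ_eq_zero : ∀ i n, ¬ p i n → ξ i n = 0
  α_x : ∀ i n, p i n → R.α i (x i n) = y i n
  β_x : ∀ i n, p (i + 1) (n + carry i) → R.β i (x (i + 1) (n + carry i)) = y i n
  η_α : ∀ i n, q i n → ∀ u, η i n (R.α i u) = ξ i n u
  η_β : ∀ i n, q i n → ∀ u, η i n (R.β i u) = ξ (i + 1) (n + carry i) u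
  ξ_x : ∀ i n, p i n → ξ i n (x i n) = 1
  η_y : ∀ i n, q i n → η i n (y i n) = 1
  triangular : (∀ i n n', n < n' →
      (p i n → p i n' → ξ i n' (x i n) = 0) ∧ (q i n → q i n' → η i n' (y i n) = 0)) ∨
    ∀ i n n', n' < n →
      (p i n → p i n' → ξ i n' (x i n) = 0) ∧ (q i n → q i n' → η i n' (y i n) = 0)

variable (R : QuiverRep.{v, w} K m)

/-- The direct sum of all the vector spaces of a representation. -/
abbrev Total : Type w := (∀ i, R.V i) × (∀ i, R.W i)

/-- The linear relation on the total space given by the forward maps on the odd vertices and by the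
inverses of the backward maps on the even ones. -/
def relation : Submodule K (R.Total × R.Total) where
  carrier := {p | ∀ i, R.α i (p.1.1 i) = p.2.2 i ∧ p.1.2 i = R.β i (p.2.1 (i + 1))}
  zero_mem' := by simp
  add_mem' := by
    intro a b ha hb i
    simp [(ha i).1, (hb i).1, (ha i).2, (hb i).2]
  smul_mem' := by
    intro c a ha i
    simp [(ha i).1, (ha i).2]

open Classical in
/-- The projection of the total space to the vertex below a position of the line. -/
def vertexProj (L : ℤ) : R.Total →ₗ[K] R.Total :=
  LinearMap.prodMap
    (LinearMap.pi fun i => if ∃ n, L = pos i n then LinearMap.proj i else 0)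
    (LinearMap.pi fun i => if ∃ n, L = pos i n + 1 then LinearMap.proj i else 0)

open Classical in
theorem vertexProj_fst (L : ℤ) (u : R.Total) (i : Fin m) :
    (R.vertexProj L u).1 i = if ∃ n, L = pos i n then u.1 i else 0 := by
  simp only [vertexProj, LinearMap.prodMap_apply, LinearMap.pi_apply]
  split_ifs <;> rfl

open Classical in
theorem vertexProj_snd (L : ℤ) (u : R.Total) (i : Fin m) :
    (R.vertexProj L u).2 i = if ∃ n, L = pos i n + 1 then u.2 i else 0 := by
  simp only [vertexProj, LinearMap.prodMap_apply, LinearMap.pi_apply]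
  split_ifs <;> rfl

/-- The relation has degree one on the covering line: `α` goes from an odd position to the next even
one, and the inverse of `β` from there to the next odd one. -/
theorem vertexProj_mem_relation (L : ℤ) {p : R.Total × R.Total} (hp : p ∈ R.relation) :
    (R.vertexProj L p.1, R.vertexProj (L + 1) p.2) ∈ R.relation := by
  intro i
  have h₁ : (∃ n, L + 1 = pos i n + 1) ↔ ∃ n, L = pos i n :=
    exists_congr fun n => by omega
  have h₂ : (∃ n, L + 1 = pos (i + 1) n) ↔ ∃ n, L = pos i n + 1 := by
    rw [exists_pos_iff]
    exact exists_congr fun n => by omega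
  simp only [vertexProj_fst, vertexProj_snd]
  constructor
  · by_cases h : ∃ n, L = pos i n
    · rw [if_pos h, if_pos (h₁.2 h)]
      exact (hp i).1
    · rw [if_neg h, if_neg (mt h₁.1 h), map_zero]
  · by_cases h : ∃ n, L = pos i n + 1
    · rw [if_pos h, if_pos (h₂.2 h)]
      exact (hp i).2
    · rw [if_neg h, if_neg (mt h₂.1 h), map_zero]

theorem vertexProj_pos (i : Fin m) (n : ℤ) (u : R.Total) :
    R.vertexProj (pos i n) u = (Pi.single i (u.1 i), 0) := by
  refine Prod.ext (funext fun j => ?_) (funext fun j => ?_)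
  · rw [vertexProj_fst]
    by_cases h : j = i
    · subst h
      rw [if_pos ⟨n, rfl⟩]
      simp
    · rw [if_neg]
      · exact (Pi.single_eq_of_ne h _).symm
      rintro ⟨n', h'⟩
      exact h (pos_eq_iff.1 h').1.symm
  · rw [vertexProj_snd, if_neg]
    · rfl
    · rintro ⟨n', h'⟩
      exact pos_add_one_ne _ _ _ _ h'.symm

theorem vertexProj_pos_add_one (i : Fin m) (n : ℤ) (u : R.Total) :
    R.vertexProj (pos i n + 1) u = (0, Pi.single i (u.2 i)) := by
  refine Prod.ext (funext fun j => ?_) (funext fun j => ?_)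
  · rw [vertexProj_fst, if_neg]
    · rfl
    · rintro ⟨n', h'⟩
      exact pos_add_one_ne _ _ _ _ h'
  · rw [vertexProj_snd]
    by_cases h : j = i
    · subst h
      rw [if_pos ⟨n, rfl⟩]
      simp
    · rw [if_neg]
      · exact (Pi.single_eq_of_ne h _).symm
      rintro ⟨n', h'⟩
      exact h (pos_eq_iff.1 (add_right_cancel h')).1.symm

/-- Each of the `2 m` vertices lies below exactly one position of a window of length `2 m`. -/
theorem sum_vertexProj (n : ℤ) (u : R.Total) :
    ∑ L ∈ Finset.Icc (1 : ℤ) (2 * m), R.vertexProj (L + n) u = u := by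
  classical
  refine Prod.ext (funext fun i => ?_) (funext fun i => ?_)
  · rw [Prod.fst_sum, Finset.sum_apply]
    simp only [vertexProj_fst]
    obtain ⟨L, ⟨hL, k, hk⟩, huniq⟩ := existsUnique_window (m := m) (pos i 0 - n)
    rw [Finset.sum_eq_single_of_mem L (Finset.mem_Icc.2 hL), if_pos]
    · exact ⟨k, by have := pos_add_turns i 0 k; rw [zero_add] at this; omega⟩
    · rintro L' hL' hne
      rw [if_neg]
      rintro ⟨k', hk'⟩
      refine hne (huniq L' ⟨Finset.mem_Icc.1 hL', k', ?_⟩)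
      have := pos_add_turns i 0 k'; rw [zero_add] at this; omega
  · rw [Prod.snd_sum, Finset.sum_apply]
    simp only [vertexProj_snd]
    obtain ⟨L, ⟨hL, k, hk⟩, huniq⟩ := existsUnique_window (m := m) (pos i 0 + 1 - n)
    rw [Finset.sum_eq_single_of_mem L (Finset.mem_Icc.2 hL), if_pos]
    · exact ⟨k, by have := pos_add_turns i 0 k; rw [zero_add] at this; omega⟩
    · rintro L' hL' hne
      rw [if_neg]
      rintro ⟨k', hk'⟩
      refine hne (huniq L' ⟨Finset.mem_Icc.1 hL', k', ?_⟩)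
      have := pos_add_turns i 0 k'; rw [zero_add] at this; omega

/-- The part of the line between two positions, seen on the odd vertices. -/
def OddRange (L L' : ℤ) (i : Fin m) (n : ℤ) : Prop := L ≤ pos i n ∧ pos i n ≤ L'

/-- The part of the line between two positions, seen on the even vertices. -/
def EvenRange (L L' : ℤ) (i : Fin m) (n : ℤ) : Prop := L ≤ pos i n + 1 ∧ pos i n + 1 ≤ L'

/-- The kernel of `β i` is indeterminacy of its inverse: its vectors are related to `0`. -/
theorem image_bot_ne_bot {i : Fin m} (h : ¬ Function.Injective (R.β i)) :
    LinRel.image R.relation ⊥ ≠ ⊥ := by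
  rw [← LinearMap.ker_eq_bot, ← ne_eq, Submodule.ne_bot_iff] at h
  obtain ⟨u, hu, hu0⟩ := h
  rw [Submodule.ne_bot_iff]
  refine ⟨(Pi.single (i + 1) u, 0), LinRel.mem_image.2 ⟨0, rfl, fun j => ⟨by simp, ?_⟩⟩, ?_⟩
  · by_cases hj : j = i
    · subst hj
      simpa using (LinearMap.mem_ker.1 hu).symm
    · have : j + 1 ≠ i + 1 := fun h => hj (by simpa using h)
      simp [Pi.single_eq_of_ne this]
  · intro h
    apply hu0
    simpa using congr_fun (congrArg Prod.fst h) (i + 1)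

theorem image_top_ne_top {i : Fin m} (h : ¬ Function.Surjective (R.α i)) :
    LinRel.image R.relation ⊤ ≠ ⊤ := by
  intro htop
  refine h fun w => ?_
  obtain ⟨p, -, hp⟩ := LinRel.mem_image.1 (htop.symm ▸ Submodule.mem_top :
    ((0, Pi.single i w) : R.Total) ∈ LinRel.image R.relation ⊤)
  exact ⟨p.1 i, by simpa using (hp i).1⟩

open Classical in
/-- A representation of which some backward map is not injective, or some forward map is not
surjective, contains a strand. -/
theorem exists_strand [∀ i, FiniteDimensional K (R.V i)] [∀ i, FiniteDimensional K (R.W i)]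
    (h : (∃ i, ¬ Function.Injective (R.β i)) ∨ ∃ i, ¬ Function.Surjective (R.α i)) :
    ∃ L L' : ℤ, 1 ≤ L ∧ L ≤ 2 * m ∧ L ≤ L' ∧
      Nonempty (R.Strand (OddRange L L') (EvenRange L L')) := by
  obtain ⟨L, N, v, ψ, hL₁, hL₂, hv, hψ, hpair, hstart, hend, htri⟩ :=
    LinRel.exists_string (C := R.relation) (2 * m) R.vertexProj
      (fun L p hp => R.vertexProj_mem_relation L hp)
      (by
        intro ψ u hu n
        by_contra! hno
        apply hu
        rw [← R.sum_vertexProj n u, map_sum]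
        exact Finset.sum_eq_zero fun L hL =>
          hno L (Finset.mem_Icc.1 hL).1 (Finset.mem_Icc.1 hL).2)
      (h.imp (fun ⟨i, hi⟩ => R.image_bot_ne_bot hi) fun ⟨i, hi⟩ => R.image_top_ne_top hi)
  have hodd : ∀ (i : Fin m) (n : ℤ), OddRange L (L + N) i n → ∃ k : ℕ, (pos i n - L).toNat = k ∧ k ≤ N ∧
      pos i n = L + k := by
    rintro i n ⟨h₁, h₂⟩
    exact ⟨_, rfl, by omega, by omega⟩
  have heven : ∀ (i : Fin m) (n : ℤ), EvenRange L (L + N) i n → ∃ k : ℕ, (pos i n + 1 - L).toNat = k ∧ k ≤ N ∧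
      pos i n + 1 = L + k := by
    rintro i n ⟨h₁, h₂⟩
    exact ⟨_, rfl, by omega, by omega⟩
  have hpV : ∀ (i : Fin m) (n : ℤ) (k : ℕ), k ≤ N → pos i n = L + k →
      ψ k (Pi.single i ((v k).1 i), 0) = 1 := by
    intro i n k hk hpos
    rw [← hpair k hk, ← hpos, vertexProj_pos]
  have hpW : ∀ (i : Fin m) (n : ℤ) (k : ℕ), k ≤ N → pos i n + 1 = L + k →
      ψ k (0, Pi.single i ((v k).2 i)) = 1 := by
    intro i n k hk hpos
    rw [← hpair k hk, ← hpos, vertexProj_pos_add_one]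
  -- These elementary pairs turn statements about all of `C` into statements about a single `α i` or
  -- `β i`.
  have hαC : ∀ i (u : R.V i), (((Pi.single i u, 0), (0, Pi.single i (R.α i u))) :
      R.Total × R.Total) ∈ R.relation := by
    intro i u j
    refine ⟨?_, by simp⟩
    by_cases hj : j = i
    · subst hj; simp
    · simp [Pi.single_eq_of_ne hj]
  have hβC : ∀ i (u : R.V (i + 1)), (((0, Pi.single i (R.β i u)), (Pi.single (i + 1) u, 0)) :
      R.Total × R.Total) ∈ R.relation := by
    intro i u j
    refine ⟨by simp, ?_⟩
    by_cases hj : j = i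
    · subst hj; simp
    · have : j + 1 ≠ i + 1 := fun h => hj (by simpa using h)
      simp [Pi.single_eq_of_ne hj, Pi.single_eq_of_ne this]
  let x : ∀ i, ℤ → R.V i := fun i n =>
    if OddRange L (L + N) i n then (v (pos i n - L).toNat).1 i else 0
  let y : ∀ i, ℤ → R.W i := fun i n =>
    if EvenRange L (L + N) i n then (v (pos i n + 1 - L).toNat).2 i else 0
  let ξ : ∀ i, ℤ → Dual K (R.V i) := fun i n =>
    if OddRange L (L + N) i n then
      (ψ (pos i n - L).toNat).comp ((LinearMap.inl K _ _).comp (LinearMap.single K R.V i)) else 0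
  let η : ∀ i, ℤ → Dual K (R.W i) := fun i n =>
    if EvenRange L (L + N) i n then
      (ψ (pos i n + 1 - L).toNat).comp ((LinearMap.inr K _ _).comp (LinearMap.single K R.W i))
      else 0
  have hx : ∀ (i : Fin m) (n : ℤ), OddRange L (L + N) i n → x i n = (v (pos i n - L).toNat).1 i :=
    fun i n h => if_pos h
  have hy : ∀ (i : Fin m) (n : ℤ), EvenRange L (L + N) i n → y i n = (v (pos i n + 1 - L).toNat).2 i :=
    fun i n h => if_pos h
  have hξ : ∀ (i : Fin m) (n : ℤ), OddRange L (L + N) i n → ∀ u, ξ i n u =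
      ψ (pos i n - L).toNat (Pi.single i u, 0) := fun i n h u => by
    simp only [ξ, if_pos h]; rfl
  have hη : ∀ (i : Fin m) (n : ℤ), EvenRange L (L + N) i n → ∀ u, η i n u =
      ψ (pos i n + 1 - L).toNat (0, Pi.single i u) := fun i n h u => by
    simp only [η, if_pos h]; rfl
  have hy0 : ∀ (i : Fin m) (n : ℤ), ¬ EvenRange L (L + N) i n → y i n = 0 := fun i n h => if_neg h
  have hξ0 : ∀ (i : Fin m) (n : ℤ), ¬ OddRange L (L + N) i n → ξ i n = 0 := fun i n h => if_neg h
  refine ⟨L, L + N, hL₁, hL₂, by omega, ⟨⟨x, y, ξ, η, hy0, hξ0, ?_, ?_, ?_, ?_, ?_, ?_, ?_⟩⟩⟩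
  · intro i n hp
    obtain ⟨k, hk, hkN, hpos⟩ := hodd i n hp
    rw [hx i n hp, hk]
    rcases hkN.lt_or_eq with hlt | rfl
    · rw [hy i n ⟨by omega, by omega⟩, show (pos i n + 1 - L).toNat = k + 1 by omega]
      exact (hv k hlt i).1
    · rw [hy0 i n (fun h => by have := h.2; omega)]
      -- At a last odd position only the kernel case can occur. `α i` is defined everywhere, so a
      -- functional killing the domain of `C` could not have pairing `1` there.
      rcases hend with h | h
      · exact (h i).1
      · have h1 := hpV i n k le_rfl hpos
        rw [h _ (hαC i _)] at h1
        exact absurd h1 zero_ne_one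
  · intro i n hp
    obtain ⟨k, hk, hkN, hpos⟩ := hodd _ _ hp
    have hpos' := hpos
    rw [pos_succ] at hpos'
    rw [hx _ _ hp, hk]
    rcases Nat.eq_zero_or_pos k with rfl | hk0
    · rw [hy0 i n (fun h => by have := h.1; push_cast at hpos'; omega)]
      -- At a first odd position every vector `u` is in the range, by the pair `(β i u, u)`. So `v
      -- 0` must come from `0`, which gives `β i (v 0) = 0`.
      rcases hstart with h | h
      · exact ((h i).2).symm
      · have h1 := hpV _ _ 0 hkN hpos
        rw [h _ (hβC i _)] at h1
        exact absurd h1 zero_ne_one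
    · obtain ⟨l, rfl⟩ := Nat.exists_eq_succ_of_ne_zero hk0.ne'
      push_cast at hpos'
      rw [hy i n ⟨by omega, by omega⟩, show (pos i n + 1 - L).toNat = l by omega]
      exact ((hv l (by omega) i).2).symm
  · intro i n hq u
    obtain ⟨k, hk, hkN, hpos⟩ := heven i n hq
    rw [hη i n hq, hk]
    rcases Nat.eq_zero_or_pos k with rfl | hk0
    · rw [hξ0 i n (fun h => by have := h.1; push_cast at hpos; omega)]
      -- At a first even position the roles are exchanged: coming from `0` would force the component
      -- of `v 0` to vanish, so `ψ 0` kills the range of `α i`.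
      rcases hstart with h | h
      · have h1 := hpW i n 0 hkN hpos
        have h2 : (v 0).2 i = 0 := by simpa using ((h i).1).symm
        rw [h2, Pi.single_zero] at h1
        exact absurd ((map_zero (ψ 0)).symm.trans h1) zero_ne_one
      · exact h _ (hαC i u)
    · obtain ⟨l, rfl⟩ := Nat.exists_eq_succ_of_ne_zero hk0.ne'
      push_cast at hpos
      rw [hξ i n ⟨by omega, by omega⟩, show (pos i n - L).toNat = l by omega]
      exact (hψ l (by omega) _ (hαC i u)).symm
  · intro i n hq u
    obtain ⟨k, hk, hkN, hpos⟩ := heven i n hq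
    have hs := pos_succ i n
    rw [hη i n hq, hk]
    rcases hkN.lt_or_eq with hlt | rfl
    · rw [hξ _ _ ⟨by omega, by omega⟩,
        show (pos (i + 1) (n + carry i) - L).toNat = k + 1 by omega]
      exact hψ k hlt _ (hβC i u)
    · rw [hξ0 _ _ (fun h => by have := h.2; omega)]
      -- At a last even position a kernel vector would be `β i 0 = 0`, so the last functional kills
      -- the range of `β i`.
      rcases hend with h | h
      · have h1 := hpW i n k le_rfl hpos
        have h2 : (v k).2 i = 0 := by simpa using (h i).2
        rw [h2, Pi.single_zero] at h1
        exact absurd ((map_zero (ψ k)).symm.trans h1) zero_ne_one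
      · exact h _ (hβC i u)
  · intro i n hp
    obtain ⟨k, hk, hkN, hpos⟩ := hodd i n hp
    rw [hξ i n hp, hx i n hp, hk]
    exact hpV i n k hkN hpos
  · intro i n hq
    obtain ⟨k, hk, hkN, hpos⟩ := heven i n hq
    rw [hη i n hq, hy i n hq, hk]
    exact hpW i n k hkN hpos
  · have key : ∀ (i : Fin m) (n n' : ℤ), (∀ k k' : ℕ, k ≤ N → k' ≤ N → (k' : ℤ) - k = pos i n' - pos i n →
        ψ k' (R.vertexProj (L + k) (v k)) = 0) →
        (OddRange L (L + N) i n → OddRange L (L + N) i n' → ξ i n' (x i n) = 0) ∧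
        (EvenRange L (L + N) i n → EvenRange L (L + N) i n' → η i n' (y i n) = 0) := by
      intro i n n' H
      constructor
      · intro hp hp'
        obtain ⟨k, hk, hkN, hpos⟩ := hodd i n hp
        obtain ⟨k', hk', hkN', hpos'⟩ := hodd i n' hp'
        have := H k k' hkN hkN' (by omega)
        rw [← hpos, vertexProj_pos] at this
        rw [hξ i n' hp', hx i n hp, hk, hk', this]
      · intro hp hp'
        obtain ⟨k, hk, hkN, hpos⟩ := heven i n hp
        obtain ⟨k', hk', hkN', hpos'⟩ := heven i n' hp'
        have := H k k' hkN hkN' (by omega)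
        rw [← hpos, vertexProj_pos_add_one] at this
        rw [hη i n' hp', hy i n hp, hk, hk', this]
    refine htri.imp (fun H i n n' hnn => key i n n' fun k k' hk hk' hkk => ?_)
      fun H i n n' hnn => key i n n' fun k k' hk hk' hkk => ?_
    · have := pos_strictMono i hnn
      exact H k k' (by omega) hk'
    · have := pos_strictMono i hnn
      exact H k k' (by omega) hk

end QuiverRep

/-! ### Isomorphisms, direct sums and split subrepresentations -/

namespace QuiverRep

open Module

section Iso

variable {K : Type v} [Field K] {m : ℕ} [NeZero m]

theorem IsIsomorphic.symm {R : QuiverRep.{v, w} K m} {R' : QuiverRep.{v, w'} K m}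
    (h : R.IsIsomorphic R') : R'.IsIsomorphic R := by
  obtain ⟨eV, eW, hα, hβ⟩ := h
  refine ⟨fun i => (eV i).symm, fun i => (eW i).symm, fun i x => ?_, fun i x => ?_⟩
  · rw [LinearEquiv.symm_apply_eq, hα, LinearEquiv.apply_symm_apply]
  · rw [LinearEquiv.symm_apply_eq, hβ, LinearEquiv.apply_symm_apply]

theorem IsIsomorphic.trans {R : QuiverRep.{v, w} K m} {R' : QuiverRep.{v, w'} K m}
    {R'' : QuiverRep.{v, w''} K m} (h : R.IsIsomorphic R') (h' : R'.IsIsomorphic R'') :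
    R.IsIsomorphic R'' := by
  obtain ⟨eV, eW, hα, hβ⟩ := h
  obtain ⟨eV', eW', hα', hβ'⟩ := h'
  exact ⟨fun i => (eV i).trans (eV' i), fun i => (eW i).trans (eW' i),
    fun i x => by simp [hα, hα'], fun i x => by simp [hβ, hβ']⟩

/-- The direct sum of two representations. -/
def prod (R : QuiverRep.{v, w} K m) (R' : QuiverRep.{v, w'} K m) :
    QuiverRep.{v, max w w'} K m where
  V i := R.V i × R'.V i
  W i := R.W i × R'.W i
  α i := (R.α i).prodMap (R'.α i)
  β i := (R.β i).prodMap (R'.β i)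

theorem IsIsomorphic.prod_left (R : QuiverRep.{v, w} K m) {R' : QuiverRep.{v, w'} K m}
    {R'' : QuiverRep.{v, w''} K m} (h : R'.IsIsomorphic R'') :
    (R.prod R').IsIsomorphic (R.prod R'') := by
  obtain ⟨eV, eW, hα, hβ⟩ := h
  exact ⟨fun i => (LinearEquiv.refl K _).prodCongr (eV i),
    fun i => (LinearEquiv.refl K _).prodCongr (eW i),
    fun i x => Prod.ext rfl (hα i x.2), fun i x => Prod.ext rfl (hβ i x.2)⟩

theorem isIsomorphic_directSum_option {ι : Type} [Finite ι]
    (F : Option ι → QuiverRep.{v, w} K m) :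
    ((F none).prod (directSum fun j => F (some j))).IsIsomorphic (directSum F) := by
  refine IsIsomorphic.symm ⟨fun i => LinearEquiv.piOptionEquivProd K,
    fun i => LinearEquiv.piOptionEquivProd K, fun i x => rfl, fun i x => rfl⟩

theorem isIsomorphic_directSum_comp {ι ι' : Type} [Finite ι] [Finite ι']
    (F : ι' → QuiverRep.{v, w} K m) (σ : ι ≃ ι') :
    (directSum fun j => F (σ j)).IsIsomorphic (directSum F) := by
  refine IsIsomorphic.symm ⟨fun i => LinearEquiv.ofBijective
      (LinearMap.pi fun j => LinearMap.proj (R := K) (φ := fun j => (F j).V i) (σ j)) ?_,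
    fun i => LinearEquiv.ofBijective
      (LinearMap.pi fun j => LinearMap.proj (R := K) (φ := fun j => (F j).W i) (σ j)) ?_,
    fun i x => rfl, fun i x => rfl⟩
  · exact (Equiv.piCongrLeft (fun j => (F j).V i) σ).symm.bijective
  · exact (Equiv.piCongrLeft (fun j => (F j).W i) σ).symm.bijective

/-- A morphism from `I` to `R`, followed by a morphism to `I` such that the composition is bijective,
splits `I` off from `R`. -/
theorem exists_isIsomorphic_prod {I : QuiverRep.{v, w} K m} {R : QuiverRep.{v, w'} K m}
    (fV : ∀ i, I.V i →ₗ[K] R.V i) (fW : ∀ i, I.W i →ₗ[K] R.W i)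
    (hfα : ∀ i x, fW i (I.α i x) = R.α i (fV i x))
    (hfβ : ∀ i x, fW i (I.β i x) = R.β i (fV (i + 1) x))
    (gV : ∀ i, R.V i →ₗ[K] I.V i) (gW : ∀ i, R.W i →ₗ[K] I.W i)
    (hgα : ∀ i x, gW i (R.α i x) = I.α i (gV i x))
    (hgβ : ∀ i x, gW i (R.β i x) = I.β i (gV (i + 1) x))
    (hV : ∀ i, Function.Bijective ((gV i).comp (fV i)))
    (hW : ∀ i, Function.Bijective ((gW i).comp (fW i))) :
    ∃ R' : QuiverRep.{v, w'} K m, R.IsIsomorphic (I.prod R') := by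
  -- If `g ∘ f` is bijective, then `N` is the direct sum of the range of `f` and the kernel of `g`;
  -- since `g` is a morphism, these kernels form a subrepresentation.
  have key : ∀ {M N : Type _} [AddCommGroup M] [AddCommGroup N] [Module K M] [Module K N]
      (f : M →ₗ[K] N) (g : N →ₗ[K] M), Function.Bijective (g.comp f) →
      Function.Bijective (f.coprod (LinearMap.ker g).subtype) := by
    intro M N _ _ _ _ f g h
    constructor
    · rw [← LinearMap.ker_eq_bot, LinearMap.ker_eq_bot']
      rintro ⟨a, k, hk⟩ h0
      have h0' : f a + k = 0 := by simpa using h0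
      have h1 : g.comp f a = g.comp f 0 := by
        have := congrArg g h0'
        rw [map_add, LinearMap.mem_ker.1 hk] at this
        simpa using this
      have ha := h.1 h1
      subst ha
      simpa using h0'
    · intro y
      obtain ⟨a, ha⟩ := h.2 (g y)
      refine ⟨(a, ⟨y - f a, ?_⟩), by simp⟩
      rw [LinearMap.mem_ker, map_sub, ← ha]
      simp
  let R' : QuiverRep.{v, w'} K m :=
    { V := fun i => LinearMap.ker (gV i)
      W := fun i => LinearMap.ker (gW i)
      α := fun i => (R.α i).restrict fun x hx => by
        rw [LinearMap.mem_ker, hgα, LinearMap.mem_ker.1 hx, map_zero]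
      β := fun i => (R.β i).restrict fun x hx => by
        rw [LinearMap.mem_ker, hgβ, LinearMap.mem_ker.1 hx, map_zero] }
  refine ⟨R', IsIsomorphic.symm ⟨fun i => LinearEquiv.ofBijective _ (key _ _ (hV i)),
    fun i => LinearEquiv.ofBijective _ (key _ _ (hW i)), ?_, ?_⟩⟩
  · rintro i ⟨a, k⟩
    change fW i (I.α i a) + R.α i k = R.α i (fV i a + k)
    rw [map_add, hfα]
  · rintro i ⟨a, k⟩
    change fW i (I.β i a) + R.β i k = R.β i (fV (i + 1) a + k)
    rw [map_add, hfβ]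

end Iso

/-- An endomorphism of a space of finitely supported functions with a unipotent triangular matrix
is injective. -/
theorem injective_of_triangular {K H : Type*} [Field K] (T : (H →₀ K) →ₗ[K] (H →₀ K))
    (τ : H → ℤ) (hτ : Function.Injective τ)
    (h₁ : ∀ h, T (Finsupp.single h 1) h = 1)
    (h₀ : ∀ h h', τ h < τ h' → T (Finsupp.single h 1) h' = 0) : Function.Injective T := by
  rw [← LinearMap.ker_eq_bot, LinearMap.ker_eq_bot']
  intro f hf
  by_contra hne
  -- At the support point with the largest `τ`, all the other terms vanish by triangularity and the
  -- coordinate of `T f` equals that of `f`.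
  obtain ⟨h', hh', hmax⟩ := Finset.exists_max_image f.support τ (Finsupp.support_nonempty_iff.2 hne)
  have h : T f h' = f h' := by
    conv_lhs => rw [← Finsupp.sum_single f, Finsupp.sum, map_sum, Finsupp.finsetSum_apply]
    rw [Finset.sum_eq_single_of_mem h' hh']
    · rw [← mul_one (f h'), ← smul_eq_mul, ← Finsupp.smul_single, map_smul, Finsupp.smul_apply,
        h₁, smul_eq_mul]
    · intro h hh hne'
      rw [← mul_one (f h), ← smul_eq_mul, ← Finsupp.smul_single, map_smul, Finsupp.smul_apply,
        h₀ h h' (lt_of_le_of_ne (hmax h hh) fun e => hne' (hτ e)), smul_zero]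
  rw [hf] at h
  exact Finsupp.mem_support_iff.1 hh' h.symm

end QuiverRep

/-! ### Intersection points of bar codes and rays -/

namespace BarCode

variable (B : BarCode)

/-- The number of turns between the angle `x` and an intersection point. -/
def turn {x : ℝ} (h : B.hits x) : ℤ := h.2.2.choose

variable {B}

theorem hits_eq {x : ℝ} (h : B.hits x) : (h : ℝ) = x + 2 * π * B.turn h := h.2.2.choose_spec

theorem turn_eq {x : ℝ} (h : B.hits x) {n : ℤ} (hn : (h : ℝ) = x + 2 * π * n) : B.turn h = n := by
  have := hn.symm.trans (hits_eq h)
  have h2 : (n : ℝ) = B.turn h := by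
    have hp := Real.pi_pos
    have : 2 * π * (n : ℝ) = 2 * π * (B.turn h : ℝ) := by linarith
    exact mul_left_cancel₀ (by positivity) this
  exact_mod_cast h2.symm

theorem turn_injective (x : ℝ) : Function.Injective (B.turn (x := x)) := by
  intro h h' e
  apply Subtype.ext
  rw [hits_eq h, hits_eq h', e]

theorem mem_hits {x : ℝ} {n : ℤ} : x + 2 * π * n ∈ B.hits x ↔ x + 2 * π * n ∈ B.carrier :=
  ⟨fun h => h.1, fun h => ⟨h, n, rfl⟩⟩

instance (x : ℝ) : Finite (B.hits x) := by
  have hp : (0 : ℝ) < 2 * π := by have := Real.pi_pos; positivity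
  have hmem : ∀ h : B.hits x, B.turn h ∈ Set.Icc ⌈(B.left - x) / (2 * π)⌉ ⌊(B.right - x) / (2 * π)⌋ := by
    intro h
    have h1 := h.2.1.1
    have h2 := h.2.1.2.1
    rw [hits_eq h] at h1 h2
    rw [Set.mem_Icc, Int.ceil_le, Int.le_floor, div_le_iff₀ hp, le_div_iff₀ hp]
    constructor <;> linarith
  exact Finite.of_injective (fun h => (⟨B.turn h, hmem h⟩ : Set.Icc _ _)) fun h h' e =>
    turn_injective x (congrArg Subtype.val e)

open Classical in
theorem shift_single (K : Type*) [Field K] (x y d : ℝ) (h : B.hits x) :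
    B.shift K x y d (Finsupp.single h 1) =
      if h' : (h : ℝ) + d ∈ B.hits y then Finsupp.single ⟨(h : ℝ) + d, h'⟩ (1 : K) else 0 := by
  simp [shift]

-- The transposed description, by coordinates of the image, is what a morphism into the bar code
-- representation needs.
open Classical in
theorem shift_apply (K : Type*) [Field K] (x y d : ℝ) (f : B.hits x →₀ K) (h' : B.hits y) :
    B.shift K x y d f h' = if h : (h' : ℝ) - d ∈ B.hits x then f ⟨(h' : ℝ) - d, h⟩ else 0 := by
  induction f using Finsupp.induction_linear with
  | zero => simp
  | add f g hf hg =>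
    rw [map_add, Finsupp.add_apply, hf, hg]
    split_ifs <;> simp
  | single a c =>
    rw [← mul_one c, ← smul_eq_mul, ← Finsupp.smul_single, map_smul, Finsupp.smul_apply,
      shift_single]
    by_cases ha : (a : ℝ) + d = h'
    · have h1 : (a : ℝ) + d ∈ B.hits y := ha ▸ h'.2
      have h2 : (h' : ℝ) - d = a := by linarith
      have h3 : (h' : ℝ) - d ∈ B.hits x := h2 ▸ a.2
      rw [dif_pos h1, dif_pos h3]
      have e1 : (⟨(a : ℝ) + d, h1⟩ : B.hits y) = h' := Subtype.ext ha
      have e2 : (⟨(h' : ℝ) - d, h3⟩ : B.hits x) = a := Subtype.ext h2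
      rw [e1, e2]
      simp
    · have e1 : ∀ h1 : (a : ℝ) + d ∈ B.hits y, (⟨(a : ℝ) + d, h1⟩ : B.hits y) ≠ h' :=
        fun h1 e => ha (congrArg Subtype.val e)
      have e2 : ∀ h3 : (h' : ℝ) - d ∈ B.hits x, a ≠ (⟨(h' : ℝ) - d, h3⟩ : B.hits x) :=
        fun h3 e => ha (by have := congrArg Subtype.val e; simp only at this; linarith)
      split_ifs with h1 h3 h3 <;> simp [Finsupp.single_eq_of_ne', e1, e2]

end BarCode

namespace AngleSystem

open QuiverRep Module

variable {X : Type u} [TopologicalSpace X] {f : X → Circle} (S : AngleSystem f)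

theorem tNext_eq (i : Fin S.m) : S.tNext i = S.t (i + 1) + 2 * π * carry i := by
  unfold tNext carry
  split_ifs <;> simp

variable {K : Type v} [Field K]

/-- A strand of a representation along a bar code splits off the representation of the bar code. -/
theorem exists_isIsomorphic_barRep_prod (B : BarCode) (R : QuiverRep.{v, w} K S.m)
    {p q : Fin S.m → ℤ → Prop} (Z : R.Strand p q)
    (hp : ∀ i (n : ℤ), S.t i + 2 * π * n ∈ B.carrier ↔ p i n)
    (hq : ∀ i (n : ℤ), S.s i + 2 * π * n ∈ B.carrier ↔ q i n) :
    ∃ R' : QuiverRep.{v, w} K S.m, R.IsIsomorphic ((S.barRep K B).prod R') := by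
  have hpT : ∀ {i} (h : B.hits (S.t i)), p i (B.turn h) := fun {i} h =>
    (hp i _).1 (BarCode.hits_eq h ▸ h.2.1)
  have hqT : ∀ {i} (h : B.hits (S.s i)), q i (B.turn h) := fun {i} h =>
    (hq i _).1 (BarCode.hits_eq h ▸ h.2.1)
  let fV : ∀ i, (B.hits (S.t i) →₀ K) →ₗ[K] R.V i := fun i =>
    Finsupp.linearCombination K fun h => Z.x i (B.turn h)
  let fW : ∀ i, (B.hits (S.s i) →₀ K) →ₗ[K] R.W i := fun i =>
    Finsupp.linearCombination K fun h => Z.y i (B.turn h)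
  let gV : ∀ i, R.V i →ₗ[K] (B.hits (S.t i) →₀ K) := fun i =>
    (Finsupp.linearEquivFunOnFinite K K _).symm.toLinearMap.comp
      (LinearMap.pi fun h => Z.ξ i (B.turn h))
  let gW : ∀ i, R.W i →ₗ[K] (B.hits (S.s i) →₀ K) := fun i =>
    (Finsupp.linearEquivFunOnFinite K K _).symm.toLinearMap.comp
      (LinearMap.pi fun h => Z.η i (B.turn h))
  have hfV : ∀ i h, fV i (Finsupp.single h 1) = Z.x i (B.turn h) := fun i h => by simp [fV]
  have hfW : ∀ i h, fW i (Finsupp.single h 1) = Z.y i (B.turn h) := fun i h => by simp [fW]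
  have hgV : ∀ i u h, gV i u h = Z.ξ i (B.turn h) u := fun i u h => rfl
  have hgW : ∀ i u h, gW i u h = Z.η i (B.turn h) u := fun i u h => rfl
  have hbij : ∀ {H : Type} [Finite H] (T : (H →₀ K) →ₗ[K] (H →₀ K)),
      Function.Injective T → Function.Bijective T := fun T hT =>
    ⟨hT, LinearMap.injective_iff_surjective.1 hT⟩
  have hbijV : ∀ i, Function.Bijective ((gV i).comp (fV i)) := by
    intro i
    refine hbij _ ?_
    have h₁ : ∀ h, ((gV i).comp (fV i)) (Finsupp.single h 1) h = 1 := fun h => by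
      rw [LinearMap.comp_apply, hgV, hfV, Z.ξ_x i _ (hpT h)]
    rcases Z.triangular with H | H
    · refine injective_of_triangular _ _ (BarCode.turn_injective _) h₁ fun h h' hh => ?_
      rw [LinearMap.comp_apply, hgV, hfV, (H i _ _ hh).1 (hpT h) (hpT h')]
    -- For the opposite triangular shape the points are ordered by decreasing number of turns.
    · refine injective_of_triangular _ (fun h => -B.turn h)
        (neg_injective.comp (BarCode.turn_injective _)) h₁ fun h h' hh => ?_
      rw [LinearMap.comp_apply, hgV, hfV, (H i _ _ (neg_lt_neg_iff.1 hh)).1 (hpT h) (hpT h')]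
  have hbijW : ∀ i, Function.Bijective ((gW i).comp (fW i)) := by
    intro i
    refine hbij _ ?_
    have h₁ : ∀ h, ((gW i).comp (fW i)) (Finsupp.single h 1) h = 1 := fun h => by
      rw [LinearMap.comp_apply, hgW, hfW, Z.η_y i _ (hqT h)]
    rcases Z.triangular with H | H
    · refine injective_of_triangular _ _ (BarCode.turn_injective _) h₁ fun h h' hh => ?_
      rw [LinearMap.comp_apply, hgW, hfW, (H i _ _ hh).2 (hqT h) (hqT h')]
    · refine injective_of_triangular _ (fun h => -B.turn h)
        (neg_injective.comp (BarCode.turn_injective _)) h₁ fun h h' hh => ?_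
      rw [LinearMap.comp_apply, hgW, hfW, (H i _ _ (neg_lt_neg_iff.1 hh)).2 (hqT h) (hqT h')]
  refine exists_isIsomorphic_prod (I := S.barRep K B) fV fW ?_ ?_ gV gW ?_ ?_ hbijV hbijW
  · intro i
    suffices h : (fW i).comp ((S.barRep K B).α i) = (R.α i).comp (fV i) from
      fun x => LinearMap.congr_fun h x
    refine Finsupp.lhom_ext' fun h => LinearMap.ext_ring ?_
    change fW i (B.shift K _ _ _ (Finsupp.single h 1)) = R.α i (fV i (Finsupp.single h 1))
    have e : (h : ℝ) + (S.s i - S.t i) = S.s i + 2 * π * B.turn h := by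
      rw [BarCode.hits_eq h]; ring
    rw [hfV, Z.α_x i _ (hpT h), BarCode.shift_single]
    split_ifs with h'
    · rw [hfW, BarCode.turn_eq _ e]
    · rw [map_zero, Z.y_eq_zero]
      rwa [e, BarCode.mem_hits, hq] at h'
  · intro i
    suffices h : (fW i).comp ((S.barRep K B).β i) = (R.β i).comp (fV (i + 1)) from
      fun x => LinearMap.congr_fun h x
    refine Finsupp.lhom_ext' fun h => LinearMap.ext_ring ?_
    change fW i (B.shift K _ _ _ (Finsupp.single h 1)) = R.β i (fV (i + 1) (Finsupp.single h 1))
    -- `β i` goes back to the vertex with index `i`, whose turn is one less when `i + 1` wraps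
    -- around to `0`.
    obtain ⟨n, hn⟩ : ∃ n, B.turn h = n + carry i := ⟨_, (sub_add_cancel _ _).symm⟩
    have e : (h : ℝ) + (S.s i - S.tNext i) = S.s i + 2 * π * n := by
      rw [BarCode.hits_eq h, hn, tNext_eq]; push_cast; ring
    rw [hfV, hn, Z.β_x i n (hn ▸ hpT h), BarCode.shift_single]
    split_ifs with h'
    · rw [hfW, BarCode.turn_eq _ e]
    · rw [map_zero, Z.y_eq_zero]
      rwa [e, BarCode.mem_hits, hq] at h'
  · intro i u
    refine Finsupp.ext fun h => ?_
    change gW i (R.α i u) h = B.shift K _ _ _ (gV i u) h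
    have e : (h : ℝ) - (S.s i - S.t i) = S.t i + 2 * π * B.turn h := by
      rw [BarCode.hits_eq h]; ring
    rw [hgW, Z.η_α i _ (hqT h), BarCode.shift_apply]
    split_ifs with h'
    · rw [hgV, BarCode.turn_eq ⟨_, h'⟩ e]
    · rw [Z.ξ_eq_zero, LinearMap.zero_apply]
      rwa [e, BarCode.mem_hits, hp] at h'
  · intro i u
    refine Finsupp.ext fun h => ?_
    change gW i (R.β i u) h = B.shift K _ _ _ (gV (i + 1) u) h
    have e : (h : ℝ) - (S.s i - S.tNext i) =
        S.t (i + 1) + 2 * π * ((B.turn h + carry i : ℤ) : ℝ) := by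
      rw [BarCode.hits_eq h, tNext_eq]; push_cast; ring
    rw [hgW, Z.η_β i _ (hqT h), BarCode.shift_apply]
    split_ifs with h'
    · rw [hgV, BarCode.turn_eq ⟨_, h'⟩ e]
    · rw [Z.ξ_eq_zero, LinearMap.zero_apply]
      rwa [e, BarCode.mem_hits, hp] at h'

end AngleSystem

/-! ### Bar codes from parts of the covering line -/

namespace QuiverRep

theorem exists_pos {m : ℕ} [NeZero m] (L : ℤ) :
    ∃ (i : Fin m) (n : ℤ), L = pos i n ∨ L = pos i n + 1 := by
  have hm : (0 : ℤ) < m := by exact_mod_cast NeZero.pos m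
  have h₁ := Int.emod_nonneg (L / 2) hm.ne'
  have h₂ := Int.emod_lt_of_pos (L / 2) hm
  have h₃ := Int.emod_add_mul_ediv (L / 2) m
  refine ⟨⟨(L / 2 % m).toNat, by omega⟩, L / 2 / m, ?_⟩
  unfold pos
  rw [Int.toNat_of_nonneg h₁, h₃]
  omega

/-- As `0 ≤ i < m`, the order of the numbers `i + m n` is lexicographic in `(n, i)`. -/
theorem pos_lt_iff {m : ℕ} [NeZero m] {i j : Fin m} {n n' : ℤ} :
    pos i n < pos j n' ↔ n < n' ∨ n = n' ∧ i < j := by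
  have hm : (0 : ℤ) < m := by exact_mod_cast NeZero.pos m
  have hi : ((i : ℕ) : ℤ) < m := by exact_mod_cast i.2
  have hj : ((j : ℕ) : ℤ) < m := by exact_mod_cast j.2
  have hlt : ∀ {a b : ℤ}, a < b → (m : ℤ) * a + m ≤ m * b := fun {a b} h => by
    have := mul_le_mul_of_nonneg_left (Int.add_one_le_iff.2 h) hm.le
    linarith
  unfold pos
  rcases lt_trichotomy n n' with h | rfl | h
  · have := hlt h
    simp only [h, true_or, iff_true]
    omega
  · simp only [lt_irrefl, false_or, true_and, Fin.lt_def]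
    omega
  · have := hlt h
    constructor
    · intro h'; omega
    · rintro (h' | ⟨h', -⟩) <;> omega

end QuiverRep

namespace AngleSystem

open QuiverRep Module

variable {X : Type u} [TopologicalSpace X] {f : X → Circle} (S : AngleSystem f)

/-- Within one turn this is `s_lt_t`; across turns it uses `s ≤ 2π` and `0 < t`. From here on,
comparisons of lifted angles become comparisons of integers. -/
theorem s_lt_t_lift {i j : Fin S.m} {n n' : ℤ} (h : pos i n < pos j n') :
    S.s i + 2 * π * n < S.t j + 2 * π * n' := by
  rcases pos_lt_iff.1 h with h | ⟨rfl, h'⟩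
  · have h₁ := S.s_le i
    have h₂ := S.t_pos j
    have h₃ : ((n + 1 : ℤ) : ℝ) ≤ n' := by exact_mod_cast h
    push_cast at h₃
    have := mul_le_mul_of_nonneg_left h₃ Real.two_pi_pos.le
    linarith
  · linarith [S.s_lt_t i j h']

theorem t_lt_s_lift {i j : Fin S.m} {n n' : ℤ} (h : pos i n ≤ pos j n') :
    S.t i + 2 * π * n < S.s j + 2 * π * n' := by
  rcases h.lt_or_eq with h | h
  · linarith [S.t_lt_s i, S.t_lt_s j, S.s_lt_t_lift h]
  · obtain ⟨rfl, rfl⟩ := pos_eq_iff.1 h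
    linarith [S.t_lt_s i]

theorem s_lt_t_lift_iff {i j : Fin S.m} {n n' : ℤ} :
    S.s i + 2 * π * n ≤ S.t j + 2 * π * n' ↔ pos i n < pos j n' :=
  ⟨fun h => by
    by_contra! h'
    exact absurd (S.t_lt_s_lift h') (not_lt.2 h), fun h => (S.s_lt_t_lift h).le⟩

theorem t_lt_s_lift_iff {i j : Fin S.m} {n n' : ℤ} :
    S.t i + 2 * π * n ≤ S.s j + 2 * π * n' ↔ pos i n ≤ pos j n' :=
  ⟨fun h => by
    by_contra! h'
    exact absurd (S.s_lt_t_lift h') (not_lt.2 h), fun h => (S.t_lt_s_lift h).le⟩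

theorem s_lt_s_lift {i j : Fin S.m} {n n' : ℤ} (h : pos i n < pos j n') :
    S.s i + 2 * π * n < S.s j + 2 * π * n' := by
  linarith [S.s_lt_t_lift h, S.t_lt_s j]

theorem s_le_s_lift_iff {i j : Fin S.m} {n n' : ℤ} :
    S.s i + 2 * π * n ≤ S.s j + 2 * π * n' ↔ pos i n ≤ pos j n' := by
  refine ⟨fun h => ?_, fun h => ?_⟩
  · by_contra! h'
    exact absurd (S.s_lt_s_lift h') (not_lt.2 h)
  · rcases h.lt_or_eq with h | h
    · exact (S.s_lt_s_lift h).le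
    · obtain ⟨rfl, rfl⟩ := pos_eq_iff.1 h
      exact le_rfl

theorem s_eq_s_lift_iff {i j : Fin S.m} {n n' : ℤ} :
    S.s i + 2 * π * n = S.s j + 2 * π * n' ↔ pos i n = pos j n' := by
  rw [le_antisymm_iff, le_antisymm_iff, s_le_s_lift_iff, s_le_s_lift_iff]

theorem s_ne_t_lift (i j : Fin S.m) (n n' : ℤ) :
    S.s i + 2 * π * n ≠ S.t j + 2 * π * n' := by
  intro h
  have h₁ := S.s_lt_t_lift_iff.1 h.le
  have h₂ := S.t_lt_s_lift_iff.1 h.ge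
  omega

/-- Every part of the covering line which starts in the first turn is the set of vertices of a
bar code. -/
theorem exists_barCode {L L' : ℤ} (hL₁ : 1 ≤ L) (hL₂ : L ≤ 2 * S.m) (hLL : L ≤ L') :
    ∃ B : BarCode, S.EndsAt B ∧
      (∀ i (n : ℤ), S.t i + 2 * π * n ∈ B.carrier ↔ OddRange L L' i n) ∧
      ∀ i (n : ℤ), S.s i + 2 * π * n ∈ B.carrier ↔ EvenRange L L' i n := by
  -- A part starting at an even vertex gets a left end closed at `s i`; one starting at the odd
  -- vertex just after it gets an end open at `s i`. The window from `1` to `2 m` is the one that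
  -- keeps this end in the first turn.
  obtain ⟨i, hi⟩ : ∃ i : Fin S.m, L = pos i 0 + 1 ∨ L = pos i 0 + 2 := by
    refine ⟨⟨((L - 1) / 2).toNat, by omega⟩, ?_⟩
    unfold pos
    simp only [mul_zero, add_zero]
    omega
  obtain ⟨j, n, hj⟩ := exists_pos (m := S.m) L'
  have hle : pos i 0 ≤ pos j n := by unfold pos at *; omega
  have hn : 0 ≤ n := by
    by_contra! hn
    have := pos_lt_iff (i := j) (j := i) |>.2 (Or.inl hn)
    omega
  -- The ends coincide only if the part is a single even vertex, and then both are closed.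
  have hlt : pos i 0 < pos j n ∨ (pos i 0 = pos j n ∧ L = pos i 0 + 1 ∧ L' = pos j n + 1) := by
    unfold pos at *; omega
  have h0 : S.s i + 2 * π * ((0 : ℤ) : ℝ) = S.s i := by simp
  have e : ((n.toNat : ℕ) : ℝ) = n := by
    rw [← Int.cast_natCast, Int.toNat_of_nonneg hn]
  let B : BarCode :=
    { left := S.s i
      right := S.s j + 2 * π * n
      leftClosed := decide (L = pos i 0 + 1)
      rightClosed := decide (L' = pos j n + 1)
      left_pos := (S.t_pos i).trans (S.t_lt_s i)
      left_le := S.s_le i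
      nonempty := by
        rcases hlt with h | ⟨h, h₁, h₂⟩
        · left
          simpa using S.s_lt_s_lift h
        · right
          refine ⟨?_, by simpa using h₁, by simpa using h₂⟩
          simpa using S.s_eq_s_lift_iff.2 h }
  have hcar : ∀ φ, φ ∈ B.carrier ↔ S.s i + 2 * π * ((0 : ℤ) : ℝ) ≤ φ ∧ φ ≤ S.s j + 2 * π * n ∧
      (φ = S.s i + 2 * π * ((0 : ℤ) : ℝ) → L = pos i 0 + 1) ∧
      (φ = S.s j + 2 * π * n → L' = pos j n + 1) := by
    intro φ
    rw [h0]
    simp [B, BarCode.carrier]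
  refine ⟨B, ⟨i, j, n.toNat, rfl, by rw [e]⟩, fun k l => ?_, fun k l => ?_⟩
  · rw [hcar, s_lt_t_lift_iff, t_lt_s_lift_iff]
    simp only [(S.s_ne_t_lift _ _ _ _).symm, false_imp_iff, and_true]
    unfold OddRange pos at *
    omega
  · rw [hcar, s_le_s_lift_iff, s_le_s_lift_iff, s_eq_s_lift_iff, s_eq_s_lift_iff]
    unfold EvenRange pos at *
    omega

end AngleSystem

/-! ### Splitting off a Jordan cell -/

namespace QuiverRep

open Module

variable {K : Type v} [Field K] {m : ℕ} [NeZero m]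

/-- A representation with injective backward maps and surjective forward maps consists of
isomorphisms. -/
theorem bijective_of_injective_of_surjective (R : QuiverRep.{v, w} K m)
    [∀ i, FiniteDimensional K (R.V i)] [∀ i, FiniteDimensional K (R.W i)]
    (hβ : ∀ i, Function.Injective (R.β i)) (hα : ∀ i, Function.Surjective (R.α i)) (i : Fin m) :
    Function.Bijective (R.α i) ∧ Function.Bijective (R.β i) := by
  have h₁ : ∀ i, finrank K (R.W i) ≤ finrank K (R.V i) := fun i =>
    LinearMap.finrank_le_finrank_of_surjective (hα i)
  have h₂ : ∀ i, finrank K (R.V (i + 1)) ≤ finrank K (R.W i) := fun i =>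
    LinearMap.finrank_le_finrank_of_injective (hβ i)
  -- The dimensions cannot increase around the cycle, and they return to their starting value, so
  -- all are equal.
  have hsum : ∑ i, finrank K (R.V (i + 1)) = ∑ i, finrank K (R.V i) :=
    Equiv.sum_comp (Equiv.addRight (1 : Fin m)) fun i => finrank K (R.V i)
  have heq := (Finset.sum_eq_sum_iff_of_le fun i _ => (h₂ i).trans (h₁ i)).1 hsum i
    (Finset.mem_univ i)
  have e₁ : finrank K (R.V i) = finrank K (R.W i) := le_antisymm (heq ▸ h₂ i) (h₁ i)
  have e₂ : finrank K (R.V (i + 1)) = finrank K (R.W i) := heq.trans e₁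
  exact ⟨⟨(LinearMap.injective_iff_surjective_of_finrank_eq_finrank e₁).2 (hα i), hα i⟩,
    hβ i, (LinearMap.injective_iff_surjective_of_finrank_eq_finrank e₂).1 (hβ i)⟩

/-- Isomorphisms from the members of a cyclic family of vector spaces to the member with index `0`,
obtained by composing isomorphisms between consecutive members. -/
def trivialization {V : Fin m → Type w} [∀ i, AddCommGroup (V i)] [∀ i, Module K (V i)]
    (γ : ∀ i, V i ≃ₗ[K] V (i + 1)) (i : Fin m) : V i ≃ₗ[K] V 0 :=
  if h : i = 0 then h ▸ LinearEquiv.refl K (V i) else (γ i).trans (trivialization γ (i + 1))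
-- The number of steps until the index reaches `0`.
termination_by if i = 0 then 0 else m - i
decreasing_by
  rw [if_neg h]
  have hi := i.2
  split_ifs with h'
  · omega
  · have := val_add_one_add_carry i
    unfold carry at this
    rw [if_neg h'] at this
    omega

/-- The index `0` is excluded: the step from there is where the monodromy of the cycle enters. -/
theorem trivialization_apply {V : Fin m → Type w} [∀ i, AddCommGroup (V i)]
    [∀ i, Module K (V i)] (γ : ∀ i, V i ≃ₗ[K] V (i + 1)) {i : Fin m} (h : i ≠ 0) (u : V i) :
    trivialization γ (i + 1) (γ i u) = trivialization γ i u := by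
  conv_rhs => rw [trivialization, dif_neg h]
  rfl

end QuiverRep

/-- A linear endomorphism with eigenvalue `μ` has a direct summand given by a Jordan cell. -/
theorem exists_jordan_summand {K V : Type*} [Field K] [AddCommGroup V] [Module K V]
    [FiniteDimensional K V] (T : V →ₗ[K] V) (μ : K) (hμ : Module.End.HasEigenvalue T μ) :
    ∃ (k : ℕ) (ι : (Fin k → K) →ₗ[K] V) (ρ : V →ₗ[K] (Fin k → K)), 0 < k ∧
      (∀ x, ι (Matrix.toLin' (Matrix.of fun i j : Fin k =>
        if i = j then μ else if (i : ℕ) + 1 = j then 1 else 0) x) = T (ι x)) ∧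
      (∀ u, ρ (T u) = Matrix.toLin' (Matrix.of fun i j : Fin k =>
        if i = j then μ else if (i : ℕ) + 1 = j then 1 else 0) (ρ u)) ∧
      Function.Bijective (ρ.comp ι) := by
  set N : V →ₗ[K] V := T - μ • LinearMap.id with hN
  have hT : ∀ u, T u = N u + μ • u := fun u => by simp [hN]
  have hninj : ¬ Function.Surjective N := by
    rw [← LinearMap.injective_iff_surjective, ← LinearMap.ker_eq_bot]
    obtain ⟨u, hu⟩ := hμ.exists_hasEigenvector
    intro hbot
    refine hu.2 ((Submodule.eq_bot_iff _).1 hbot u ?_)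
    simp [hN, hu.apply_eq_smul]
  let C : Submodule K (V × V) := LinearMap.graph N
  have hC : ∀ p : V × V, p ∈ C ↔ p.2 = N p.1 := fun _ => Iff.rfl
  -- The string lemma with trivial grading, for the graph of `N = T - μ`. An eigenvector makes `N`
  -- noninjective, hence nonsurjective.
  obtain ⟨L, n, v, ψ, -, -, hv, hψ, hpair, hstart, hend, htri⟩ :=
    LinRel.exists_string (C := C) 1 (fun _ => LinearMap.id) (fun _ p hp => hp)
      (fun ψ u hu n => ⟨1, le_rfl, le_rfl, hu⟩) (Or.inr (by
        intro htop
        refine hninj fun y => ?_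
        obtain ⟨x, -, hx⟩ := LinRel.mem_image.1 (htop.symm ▸ Submodule.mem_top :
          y ∈ LinRel.image C ⊤)
        exact ⟨x, ((hC _).1 hx).symm⟩))
  simp only [LinearMap.id_apply] at hpair htri
  have hvN : ∀ k < n, N (v k) = v (k + 1) := fun k hk => ((hC _).1 (hv k hk)).symm
  have hψN : ∀ k < n, ∀ u, ψ (k + 1) (N u) = ψ k u := fun k hk u =>
    (hψ k hk (u, N u) ((hC _).2 rfl)).symm
  -- For the graph of a map, a chain coming from `0` would start with `v 0 = 0`, and the domain is
  -- everything. Only one alternative survives at each end.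
  have hψ0 : ∀ u, ψ 0 (N u) = 0 := by
    rcases hstart with h | h
    · have h0 : v 0 = 0 := by simpa using (hC _).1 h
      have := hpair 0 n.zero_le
      rw [h0, map_zero] at this
      exact absurd this zero_ne_one
    · exact fun u => h (u, N u) ((hC _).2 rfl)
  have hvn : N (v n) = 0 := by
    rcases hend with h | h
    · exact ((hC _).1 h).symm
    · have := hpair n le_rfl
      rw [h (v n, N (v n)) ((hC _).2 rfl)] at this
      exact absurd this zero_ne_one
  -- The order is reversed because the ones above the diagonal lower the index of a basis vector,
  -- whereas `N` raises the index along the chain.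
  let ι : (Fin (n + 1) → K) →ₗ[K] V := Fintype.linearCombination K fun j => v (n - j)
  let ρ : V →ₗ[K] (Fin (n + 1) → K) := LinearMap.pi fun j => ψ (n - j)
  have hι : ∀ j, ι (Pi.single j 1) = v (n - j) := fun j => by
    simp [ι]
  have hρ : ∀ u j, ρ u j = ψ (n - j) u := fun u j => rfl
  refine ⟨n + 1, ι, ρ, n.succ_pos, ?_, ?_, ?_⟩
  · intro x
    revert x
    suffices h : ι.comp (Matrix.toLin' (Matrix.of fun i j : Fin (n + 1) =>
        if i = j then μ else if (i : ℕ) + 1 = j then 1 else 0)) = T.comp ι from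
      fun x => LinearMap.congr_fun h x
    refine LinearMap.pi_ext' fun j => LinearMap.ext_ring ?_
    change ι (Matrix.toLin' _ (Pi.single j 1)) = T (ι (Pi.single j 1))
    rw [hι, hT]
    have hcol : Matrix.toLin' (Matrix.of fun i j : Fin (n + 1) =>
        if i = j then μ else if (i : ℕ) + 1 = j then 1 else 0) (Pi.single j 1) =
        (fun i : Fin (n + 1) => if (i : ℕ) + 1 = j then (1 : K) else 0) + μ • Pi.single j 1 := by
      ext i
      rw [Matrix.toLin'_apply, Matrix.mulVec_single_one]
      by_cases h : i = j
      · subst h; simp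
      · simp [h, Matrix.col]
    rw [hcol, map_add, map_smul, hι]
    congr 1
    rcases j with ⟨_ | j, hj⟩
    · rw [show (fun i : Fin (n + 1) => if (i : ℕ) + 1 = ((⟨0, hj⟩ : Fin (n + 1)) : ℕ) then (1 : K)
        else 0) = 0 from funext fun i => if_neg (by simp), map_zero]
      exact hvn.symm
    · rw [show (fun i : Fin (n + 1) => if (i : ℕ) + 1 = ((⟨j + 1, hj⟩ : Fin (n + 1)) : ℕ)
        then (1 : K) else 0) = Pi.single ⟨j, by omega⟩ 1 from funext fun i => by
          rw [Pi.single_apply]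
          simp [Fin.ext_iff], hι]
      have h1 := hvN (n - (j + 1)) (by omega)
      rw [h1]
      congr 1
      simp only
      omega
  · intro u
    ext i
    rw [hρ, hT, map_add, map_smul, Matrix.toLin'_apply, Matrix.mulVec, dotProduct]
    have hrow : ∀ j : Fin (n + 1), (Matrix.of fun i j : Fin (n + 1) =>
        if i = j then μ else if (i : ℕ) + 1 = j then 1 else 0) i j * ρ u j =
        (if j = i then μ * ρ u j else 0) + if (i : ℕ) + 1 = j then ρ u j else 0 := by
      intro j
      by_cases h : i = j
      · subst h; simp
      · simp [h, Ne.symm h]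
    rw [Finset.sum_congr rfl fun j _ => hrow j, Finset.sum_add_distrib, Finset.sum_ite_eq',
      if_pos (Finset.mem_univ i), hρ, add_comm, smul_eq_mul]
    congr 1
    by_cases h : (i : ℕ) + 1 < n + 1
    · rw [Finset.sum_eq_single_of_mem (⟨(i : ℕ) + 1, h⟩ : Fin (n + 1)) (Finset.mem_univ _)]
      · rw [if_pos rfl, hρ]
        have h1 := hψN (n - ((i : ℕ) + 1)) (by omega) u
        rw [← h1]
        congr 2
        omega
      · intro j _ hj
        exact if_neg fun h' => hj (Fin.ext h'.symm)
    · rw [Finset.sum_eq_zero fun (j : Fin (n + 1)) _ => if_neg (fun h' : (i : ℕ) + 1 = (j : ℕ) => h (h' ▸ j.2)),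
        show n - (i : ℕ) = 0 by omega]
      exact hψ0 u
  · let e := Finsupp.linearEquivFunOnFinite K K (Fin (n + 1))
    let A : (Fin (n + 1) →₀ K) →ₗ[K] (Fin (n + 1) →₀ K) :=
      e.symm.toLinearMap.comp ((ρ.comp ι).comp e.toLinearMap)
    have hA : ∀ j i, A (Finsupp.single j 1) i = ψ (n - i) (v (n - j)) := by
      intro j i
      change ρ (ι (e (Finsupp.single j 1))) i = _
      rw [hρ, Finsupp.linearEquivFunOnFinite_single, hι]
    have hinj : Function.Injective A := by
      have h₁ : ∀ j, A (Finsupp.single j 1) j = 1 := fun j => by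
        rw [hA]; exact hpair _ (by omega)
      rcases htri with h | h
      · refine QuiverRep.injective_of_triangular A (fun j => -((j : ℕ) : ℤ))
          (fun a b hab => Fin.ext (by simpa using hab)) h₁ fun a b hab => ?_
        rw [hA]
        exact h _ _ (by omega) (by omega)
      · refine QuiverRep.injective_of_triangular A (fun j => ((j : ℕ) : ℤ))
          (fun a b hab => Fin.ext (by simpa using hab)) h₁ fun a b hab => ?_
        rw [hA]
        exact h _ _ (by omega) (by omega)
    have hinj' : Function.Injective (ρ.comp ι) := by
      have : (ρ.comp ι : (Fin (n + 1) → K) → _) = e ∘ A ∘ e.symm := by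
        funext x
        simp [A]
      rw [this]
      exact e.injective.comp (hinj.comp e.symm.injective)
    exact ⟨hinj', LinearMap.injective_iff_surjective.1 hinj'⟩

/-! ### Decomposition into bar codes and Jordan cells -/

namespace QuiverRep

open Module

/-- Identifying every space with `V 0` around the cycle turns all maps into identities except `α 0`,
which becomes the monodromy `T`. A Jordan summand of `T`, copied to every vertex, is a summand of
the representation. -/
theorem exists_jordanCell_prod {κ : Type v} [Field κ] {m : ℕ} [NeZero m]
    (R : QuiverRep.{v, w} (AlgebraicClosure κ) m)
    [∀ i, FiniteDimensional (AlgebraicClosure κ) (R.V i)] [Nontrivial (R.V 0)]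
    (h : ∀ i, Function.Bijective (R.α i) ∧ Function.Bijective (R.β i)) :
    ∃ (J : JordanCell κ) (R' : QuiverRep.{v, w} (AlgebraicClosure κ) m),
      R.IsIsomorphic ((J.rep m).prod R') := by
  let a : ∀ i, R.V i ≃ₗ[AlgebraicClosure κ] R.W i := fun i => LinearEquiv.ofBijective _ (h i).1
  let b : ∀ i, R.V (i + 1) ≃ₗ[AlgebraicClosure κ] R.W i := fun i =>
    LinearEquiv.ofBijective _ (h i).2
  let γ : ∀ i, R.V i ≃ₗ[AlgebraicClosure κ] R.V (i + 1) := fun i => (a i).trans (b i).symm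
  let F : ∀ i, R.V i ≃ₗ[AlgebraicClosure κ] R.V 0 := trivialization γ
  let G : ∀ i, R.W i ≃ₗ[AlgebraicClosure κ] R.V 0 := fun i => (b i).symm.trans (F (i + 1))
  let T : R.V 0 ≃ₗ[AlgebraicClosure κ] R.V 0 := (F 0).symm.trans ((a 0).trans (G 0))
  have hGα : ∀ i, i ≠ 0 → ∀ u, G i (R.α i u) = F i u := fun i hi u =>
    trivialization_apply γ hi u
  have hGβ : ∀ i u, G i (R.β i u) = F (i + 1) u := fun i u =>
    congrArg (F (i + 1)) ((b i).symm_apply_apply u)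
  have hT : ∀ u, G 0 (R.α 0 u) = T (F 0 u) := fun u => by
    simp [T, a]
  obtain ⟨μ, hμ⟩ := Module.End.exists_eigenvalue (T : R.V 0 →ₗ[AlgebraicClosure κ] R.V 0)
  have hμ0 : μ ≠ 0 := by
    rintro rfl
    obtain ⟨u, hu⟩ := hμ.exists_hasEigenvector
    have := hu.apply_eq_smul
    rw [zero_smul] at this
    exact hu.2 (T.map_eq_zero_iff.1 this)
  obtain ⟨k, ι, ρ, hk, hι, hρ, hbij⟩ := exists_jordan_summand _ μ hμ
  let J : JordanCell κ := ⟨μ, k, hμ0, hk⟩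
  refine ⟨J, exists_isIsomorphic_prod (I := J.rep m)
    (fun i => (F i).symm.toLinearMap.comp ι) (fun i => (G i).symm.toLinearMap.comp ι)
    ?_ ?_ (fun i => ρ.comp (F i).toLinearMap) (fun i => ρ.comp (G i).toLinearMap) ?_ ?_ ?_ ?_⟩
  · intro i x
    change (G i).symm (ι _) = R.α i ((F i).symm (ι x))
    rw [LinearEquiv.symm_apply_eq]
    by_cases hi : i = 0
    · subst hi
      rw [hT, LinearEquiv.apply_symm_apply]
      exact hι x
    · rw [hGα i hi, LinearEquiv.apply_symm_apply]
      simp only [JordanCell.rep, if_neg hi]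
      rfl
  · intro i x
    change (G i).symm (ι x) = R.β i ((F (i + 1)).symm (ι x))
    rw [LinearEquiv.symm_apply_eq, hGβ, LinearEquiv.apply_symm_apply]
  · intro i x
    change ρ (G i (R.α i x)) = (J.rep m).α i (ρ (F i x))
    by_cases hi : i = 0
    · subst hi
      rw [hT]
      exact hρ _
    · rw [hGα i hi]
      simp only [JordanCell.rep, if_neg hi]
      rfl
  · intro i x
    change ρ (G i (R.β i x)) = ρ (F (i + 1) x)
    rw [hGβ]
  · intro i
    have : (ρ.comp (F i).toLinearMap).comp ((F i).symm.toLinearMap.comp ι) = ρ.comp ι :=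
      LinearMap.ext fun x => congrArg ρ ((F i).apply_symm_apply (ι x))
    exact this ▸ hbij
  · intro i
    have : (ρ.comp (G i).toLinearMap).comp ((G i).symm.toLinearMap.comp ι) = ρ.comp ι :=
      LinearMap.ext fun x => congrArg ρ ((G i).apply_symm_apply (ι x))
    exact this ▸ hbij

variable {K : Type v} [Field K] {m : ℕ} [NeZero m]

/-- The sum of the dimensions of the vector spaces of a representation. -/
def totalDim (R : QuiverRep.{v, w} K m) : ℕ :=
  ∑ i, (finrank K (R.V i) + finrank K (R.W i))

/-- All the vector spaces of the representation are finite dimensional. -/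
def IsFiniteDim (R : QuiverRep.{v, w} K m) : Prop :=
  (∀ i, FiniteDimensional K (R.V i)) ∧ ∀ i, FiniteDimensional K (R.W i)

theorem IsFiniteDim.of_isIsomorphic_prod {R : QuiverRep.{v, w} K m} {I : QuiverRep.{v, w'} K m}
    {R' : QuiverRep.{v, w''} K m} (hR : R.IsFiniteDim) (h : R.IsIsomorphic (I.prod R')) :
    R'.IsFiniteDim ∧ I.IsFiniteDim ∧ R.totalDim = I.totalDim + R'.totalDim := by
  obtain ⟨eV, eW, -, -⟩ := h
  have hV := hR.1
  have hW := hR.2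
  have hPV : ∀ i, Module.Finite K (I.V i × R'.V i) := fun i => Module.Finite.equiv (eV i)
  have hPW : ∀ i, Module.Finite K (I.W i × R'.W i) := fun i => Module.Finite.equiv (eW i)
  have h₁ : R'.IsFiniteDim :=
    ⟨fun i => Module.Finite.of_surjective (LinearMap.snd K (I.V i) (R'.V i)) LinearMap.snd_surjective,
    fun i => Module.Finite.of_surjective (LinearMap.snd K (I.W i) (R'.W i)) LinearMap.snd_surjective⟩
  have h₂ : I.IsFiniteDim :=
    ⟨fun i => Module.Finite.of_surjective (LinearMap.fst K (I.V i) (R'.V i)) LinearMap.fst_surjective,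
    fun i => Module.Finite.of_surjective (LinearMap.fst K (I.W i) (R'.W i)) LinearMap.fst_surjective⟩
  refine ⟨h₁, h₂, ?_⟩
  have := h₁.1; have := h₁.2; have := h₂.1; have := h₂.2
  unfold totalDim
  rw [← Finset.sum_add_distrib]
  refine Finset.sum_congr rfl fun i _ => ?_
  rw [(eV i).finrank_eq, (eW i).finrank_eq]
  change finrank K (I.V i × R'.V i) + finrank K (I.W i × R'.W i) = _
  rw [finrank_prod, finrank_prod]
  omega

theorem totalDim_pos {R : QuiverRep.{v, w} K m} (hR : R.IsFiniteDim) {i : Fin m}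
    (h : Nontrivial (R.V i) ∨ Nontrivial (R.W i)) : 0 < R.totalDim := by
  have := hR.1; have := hR.2
  refine lt_of_lt_of_le ?_ (Finset.single_le_sum
    (f := fun i => finrank K (R.V i) + finrank K (R.W i)) (fun _ _ => Nat.zero_le _)
    (Finset.mem_univ i))
  rcases h with h | h
  · exact Nat.add_pos_left finrank_pos _
  · exact Nat.add_pos_right _ finrank_pos

end QuiverRep

namespace AngleSystem

open QuiverRep Module

variable {X : Type u} [TopologicalSpace X] {f : X → Circle} (S : AngleSystem f)

/-- Every nonzero finite dimensional representation has a direct summand which is given by a bar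
code or by a Jordan cell. -/
theorem exists_summand {κ : Type v} [Field κ] (R : QuiverRep.{v, w} (AlgebraicClosure κ) S.m)
    (hR : R.IsFiniteDim) (hpos : 0 < R.totalDim) :
    (∃ (B : BarCode) (R' : QuiverRep.{v, w} (AlgebraicClosure κ) S.m), S.EndsAt B ∧
      R.IsIsomorphic ((S.barRep (AlgebraicClosure κ) B).prod R') ∧ R'.totalDim < R.totalDim) ∨
    ∃ (J : JordanCell κ) (R' : QuiverRep.{v, w} (AlgebraicClosure κ) S.m),
      R.IsIsomorphic ((J.rep S.m).prod R') ∧ R'.totalDim < R.totalDim := by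
  have hV := hR.1
  have hW := hR.2
  by_cases h : (∃ i, ¬ Function.Injective (R.β i)) ∨ ∃ i, ¬ Function.Surjective (R.α i)
  · left
    obtain ⟨L, L', hL₁, hL₂, hLL, ⟨Z⟩⟩ := R.exists_strand h
    obtain ⟨B, hB, hp, hq⟩ := S.exists_barCode hL₁ hL₂ hLL
    obtain ⟨R', hR'⟩ := S.exists_isIsomorphic_barRep_prod B R Z hp hq
    refine ⟨B, R', hB, hR', ?_⟩
    obtain ⟨-, hI, hdim⟩ := hR.of_isIsomorphic_prod hR'
    obtain ⟨i, n, hi⟩ := exists_pos (m := S.m) L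
    -- The vertex below the first position `L` carries a point of the bar code, so the complement is
    -- strictly smaller.
    have : 0 < (S.barRep (AlgebraicClosure κ) B).totalDim := by
      refine totalDim_pos hI (i := i) (hi.imp (fun hi => ?_) fun hi => ?_)
      · have : Nonempty (B.hits (S.t i)) :=
          ⟨_, BarCode.mem_hits.2 ((hp i n).2 ⟨hi.le, hi.ge.trans hLL⟩)⟩
        exact inferInstanceAs (Nontrivial (B.hits (S.t i) →₀ AlgebraicClosure κ))
      · have : Nonempty (B.hits (S.s i)) :=
          ⟨_, BarCode.mem_hits.2 ((hq i n).2 ⟨hi.le, hi.ge.trans hLL⟩)⟩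
        exact inferInstanceAs (Nontrivial (B.hits (S.s i) →₀ AlgebraicClosure κ))
    omega
  · right
    push Not at h
    have hbij := R.bijective_of_injective_of_surjective h.1 h.2
    have hnt : Nontrivial (R.V 0) := by
      by_contra hn
      rw [not_nontrivial_iff_subsingleton] at hn
      have hVs : ∀ i, Subsingleton (R.V i) := fun i =>
        (trivialization (fun i => (LinearEquiv.ofBijective _ (hbij i).1).trans
          (LinearEquiv.ofBijective _ (hbij i).2).symm) i).toEquiv.subsingleton
      have hWs : ∀ i, Subsingleton (R.W i) := fun i => (h.2 i).subsingleton
      exact hpos.ne' (Finset.sum_eq_zero fun i _ => by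
        rw [finrank_zero_of_subsingleton, finrank_zero_of_subsingleton, add_zero])
    obtain ⟨J, R', hR'⟩ := R.exists_jordanCell_prod hbij
    refine ⟨J, R', hR', ?_⟩
    obtain ⟨-, hI, hdim⟩ := hR.of_isIsomorphic_prod hR'
    have : 0 < (J.rep S.m).totalDim := by
      refine totalDim_pos hI (i := 0) (Or.inl ?_)
      have : Nonempty (Fin J.size) := ⟨⟨0, J.size_pos⟩⟩
      exact inferInstanceAs (Nontrivial (Fin J.size → AlgebraicClosure κ))
    omega

/-- Every finite dimensional representation is a direct sum of representations given by bar codes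
and Jordan cells. -/
theorem exists_isIsomorphic_directSum {κ : Type v} [Field κ] (N : ℕ)
    (R : QuiverRep.{v, w} (AlgebraicClosure κ) S.m) (hR : R.IsFiniteDim) (hN : R.totalDim = N) :
    ∃ (p q : ℕ) (B : Fin p → BarCode) (J : Fin q → JordanCell κ), (∀ l, S.EndsAt (B l)) ∧
      R.IsIsomorphic (directSum (ι := Fin p ⊕ Fin q)
        (Sum.elim (fun l => S.barRep (AlgebraicClosure κ) (B l)) fun l => (J l).rep S.m)) := by
  induction N using Nat.strong_induction_on generalizing R with
  | _ N ih =>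
  rcases Nat.eq_zero_or_pos R.totalDim with h0 | hpos
  · have hfin := Finset.sum_eq_zero_iff.1 h0
    have := hR.1; have := hR.2
    have hV : ∀ i, Subsingleton (R.V i) := fun i =>
      finrank_zero_iff.1 (Nat.add_eq_zero_iff.1 (hfin i (Finset.mem_univ i))).1
    have hW : ∀ i, Subsingleton (R.W i) := fun i =>
      finrank_zero_iff.1 (Nat.add_eq_zero_iff.1 (hfin i (Finset.mem_univ i))).2
    refine ⟨0, 0, Fin.elim0, Fin.elim0, fun l => l.elim0, ?_⟩
    set D := directSum (ι := Fin 0 ⊕ Fin 0) (Sum.elim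
      (fun l => S.barRep (AlgebraicClosure κ) (Fin.elim0 l))
      fun l => (Fin.elim0 l : JordanCell κ).rep S.m) with hD
    have hDV : ∀ i, Subsingleton (D.V i) := fun i =>
      ⟨fun x y => funext fun l => isEmptyElim l⟩
    have hDW : ∀ i, Subsingleton (D.W i) := fun i =>
      ⟨fun x y => funext fun l => isEmptyElim l⟩
    exact ⟨fun i => 0, fun i => 0, fun i x => Subsingleton.elim _ _,
      fun i x => Subsingleton.elim _ _⟩
  rcases S.exists_summand R hR hpos with ⟨B₀, R', hB₀, hiso, hlt⟩ | ⟨J₀, R', hiso, hlt⟩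
  · obtain ⟨p, q, B, J, hB, hR'⟩ := ih _ (hN ▸ hlt) R' (hR.of_isIsomorphic_prod hiso).1 rfl
    refine ⟨p + 1, q, Fin.cons B₀ B, J, Fin.cases hB₀ hB, ?_⟩
    let F : Fin (p + 1) ⊕ Fin q → QuiverRep (AlgebraicClosure κ) S.m :=
      Sum.elim (fun l => S.barRep (AlgebraicClosure κ) ((Fin.cons B₀ B : Fin (p + 1) → BarCode) l))
        fun l => (J l).rep S.m
    -- The new bar code is `none`; it becomes the first entry of the longer list.
    let σ : Option (Fin p ⊕ Fin q) ≃ Fin (p + 1) ⊕ Fin q :=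
      { toFun := fun o => o.elim (Sum.inl 0) (Sum.map Fin.succ id)
        invFun := Sum.elim (Fin.cases none fun l => some (Sum.inl l)) fun l => some (Sum.inr l)
        left_inv := by rintro (_ | _ | _) <;> rfl
        right_inv := by
          rintro (l | l)
          · induction l using Fin.cases <;> rfl
          · rfl }
    have hF : (fun j => F (σ (some j))) =
        Sum.elim (fun l => S.barRep (AlgebraicClosure κ) (B l)) fun l => (J l).rep S.m := by
      funext j
      rcases j with j | j <;> rfl
    have h₁ := isIsomorphic_directSum_option fun o => F (σ o)
    rw [hF] at h₁
    exact (hiso.trans (IsIsomorphic.prod_left _ hR')).trans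
      (h₁.trans (isIsomorphic_directSum_comp F σ))
  · obtain ⟨p, q, B, J, hB, hR'⟩ := ih _ (hN ▸ hlt) R' (hR.of_isIsomorphic_prod hiso).1 rfl
    refine ⟨p, q + 1, B, Fin.cons J₀ J, hB, ?_⟩
    let F : Fin p ⊕ Fin (q + 1) → QuiverRep (AlgebraicClosure κ) S.m :=
      Sum.elim (fun l => S.barRep (AlgebraicClosure κ) (B l))
        fun l => ((Fin.cons J₀ J : Fin (q + 1) → JordanCell κ) l).rep S.m
    let σ : Option (Fin p ⊕ Fin q) ≃ Fin p ⊕ Fin (q + 1) :=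
      { toFun := fun o => o.elim (Sum.inr 0) (Sum.map id Fin.succ)
        invFun := Sum.elim (fun l => some (Sum.inl l)) (Fin.cases none fun l => some (Sum.inr l))
        left_inv := by rintro (_ | _ | _) <;> rfl
        right_inv := by
          rintro (l | l)
          · rfl
          · induction l using Fin.cases <;> rfl }
    have hF : (fun j => F (σ (some j))) =
        Sum.elim (fun l => S.barRep (AlgebraicClosure κ) (B l)) fun l => (J l).rep S.m := by
      funext j
      rcases j with j | j <;> rfl
    have h₁ := isIsomorphic_directSum_option fun o => F (σ o)
    rw [hF] at h₁
    exact (hiso.trans (IsIsomorphic.prod_left _ hR')).trans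
      (h₁.trans (isIsomorphic_directSum_comp F σ))

end AngleSystem

/-! ### Transport of fibres -/

open Topology

section Transport

variable {X : Type u} [TopologicalSpace X] {Y : Type v}

/-- The fibre over `y` can be moved to the fibre over `z` inside the preimage of `A`. -/
def Moves (f : X → Y) (A : Set Y) (y z : Y) : Prop :=
  ∃ (hy : {y} ⊆ A) (hz : {z} ⊆ A) (g : C(f ⁻¹' {y}, f ⁻¹' {z})),
    ContinuousMap.Homotopic ((incl f hz).comp g) (incl f hy)

variable {f : X → Y} {A : Set Y}

theorem Moves.mono {A' : Set Y} {y z : Y} (h : Moves f A y z) (hA : A ⊆ A') : Moves f A' y z := by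
  obtain ⟨hy, hz, g, hg⟩ := h
  exact ⟨hy.trans hA, hz.trans hA, g, (ContinuousMap.Homotopic.refl (incl f hA)).comp hg⟩

theorem Moves.trans {x y z : Y} (h : Moves f A x y) (h' : Moves f A y z) : Moves f A x z := by
  obtain ⟨hx, hy, g, hg⟩ := h
  obtain ⟨_, hz, g', hg'⟩ := h'
  exact ⟨hx, hz, g'.comp g,
    (hg'.comp (ContinuousMap.Homotopic.refl g)).trans hg⟩

variable [TopologicalSpace Y]

/-- In the coordinates given by `l`, the base coordinate slides along `γ` from `z` to `y`. At `y`
this ends at `l' ∘ l`, and the fibrewise homotopy leads on to the inclusion without leaving the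
fibre over `y`. -/
theorem IsFiberwiseTrivial.moves {y₀ : Y} {U : Set Y} (h : IsFiberwiseTrivial f y₀ U) (hAU : A ⊆ U)
    {y z : Y} (γ : C(unitInterval, Y)) (hγ : ∀ s, γ s ∈ A) (h₀ : γ 0 = z) (h₁ : γ 1 = y) :
    Moves f A y z := by
  obtain ⟨l, l', hl, hl', ⟨F⟩, -⟩ := h
  have hyA : {y} ⊆ A := Set.singleton_subset_iff.2 (h₁ ▸ hγ 1)
  have hzA : {z} ⊆ A := Set.singleton_subset_iff.2 (h₀ ▸ hγ 0)
  have hzU : z ∈ U := hAU (h₀ ▸ hγ 0)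
  let j : C(f ⁻¹' {y}, f ⁻¹' U) := incl f (hyA.trans hAU)
  let Φ : C(unitInterval × (f ⁻¹' {y}), f ⁻¹' U) :=
    { toFun := fun p => l' ((l (j p.2)).1, ⟨γ p.1, hAU (hγ p.1)⟩)
      continuous_toFun := by fun_prop }
  have hΦ : ∀ p, f (Φ p) = γ p.1 := fun p => hl' _
  have hF : ∀ s x, f (F (s, x)) = f x := fun s x => F.prop' s x
  have hF₀ : ∀ x, F (0, x) = l' (l x) := F.map_zero_left
  have hF₁ : ∀ x, F (1, x) = x := F.map_one_left
  let g : C(f ⁻¹' {y}, f ⁻¹' {z}) :=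
    { toFun := fun x => ⟨Φ (0, x), (hΦ (0, x)).trans h₀⟩
      continuous_toFun := by fun_prop }
  let k : C(f ⁻¹' {y}, f ⁻¹' A) :=
    { toFun := fun x => ⟨Φ (1, x), by rw [Set.mem_preimage, hΦ]; exact hγ 1⟩
      continuous_toFun := by fun_prop }
  refine ⟨hyA, hzA, g, ContinuousMap.Homotopic.trans (g := k) ⟨?_⟩ ⟨?_⟩⟩
  · exact
      { toFun := fun p => ⟨Φ p, by rw [Set.mem_preimage, hΦ]; exact hγ p.1⟩
        continuous_toFun := by fun_prop
        map_zero_left := fun x => rfl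
        map_one_left := fun x => rfl }
  · exact
      { toFun := fun p => ⟨F (p.1, j p.2), by
          rw [Set.mem_preimage, hF]
          exact hyA p.2.2⟩
        continuous_toFun := by fun_prop
        map_zero_left := fun x => by
          apply Subtype.ext
          change ((F (0, j x) : f ⁻¹' U) : X) = Φ (1, x)
          rw [hF₀]
          change (l' (l (j x)) : X) = l' ((l (j x)).1, _)
          congr 3
          refine Prod.ext rfl (Subtype.ext ?_)
          change ((l (j x)).2 : Y) = γ 1
          rw [hl, h₁]
          exact x.2
        map_one_left := fun x => by
          apply Subtype.ext
          change ((F (1, j x) : f ⁻¹' U) : X) = x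
          rw [hF₁]
          rfl }

/-- The fibres over a set over which the map is fibrewise trivial are homotopy equivalent. -/
theorem IsFiberwiseTrivial.exists_homotopyEquiv {y₀ : Y} {U : Set Y}
    (h : IsFiberwiseTrivial f y₀ U) {y : Y} (hy : y ∈ U) :
    Nonempty (ContinuousMap.HomotopyEquiv (f ⁻¹' {y}) (f ⁻¹' {y₀})) := by
  obtain ⟨l, l', hl, hl', ⟨F⟩, ⟨G⟩⟩ := h
  let j : C(f ⁻¹' {y}, f ⁻¹' U) := incl f (Set.singleton_subset_iff.2 hy)
  have hF : ∀ s x, f (F (s, x)) = f x := fun s x => F.prop' s x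
  have hF₀ : ∀ x, F (0, x) = l' (l x) := F.map_zero_left
  have hF₁ : ∀ x, F (1, x) = x := F.map_one_left
  have hG₀ : ∀ p, G (0, p) = l (l' p) := G.map_zero_left
  have hG₁ : ∀ p, G (1, p) = p := G.map_one_left
  refine ⟨⟨⟨fun x => (l (j x)).1, by fun_prop⟩,
    ⟨fun p => ⟨l' (p, ⟨y, hy⟩), hl' _⟩, by fun_prop⟩, ⟨?_⟩, ⟨?_⟩⟩⟩
  · exact
      { toFun := fun p => ⟨F (p.1, j p.2), (hF _ _).trans p.2.2⟩
        continuous_toFun := by fun_prop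
        map_zero_left := fun x => by
          apply Subtype.ext
          change ((F (0, j x) : f ⁻¹' U) : X) = l' ((l (j x)).1, _)
          rw [hF₀]
          congr 3
          refine Prod.ext rfl (Subtype.ext ?_)
          change ((l (j x)).2 : Y) = y
          rw [hl]
          exact x.2
        map_one_left := fun x => by
          apply Subtype.ext
          change ((F (1, j x) : f ⁻¹' U) : X) = x
          rw [hF₁]
          rfl }
  · exact
      { toFun := fun p => (G (p.1, (p.2, ⟨y, hy⟩))).1
        continuous_toFun := by fun_prop
        map_zero_left := fun x => by
          change (G (0, (x, ⟨y, hy⟩))).1 = _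
          rw [hG₀]
          rfl
        map_one_left := fun x => by
          change (G (1, (x, ⟨y, hy⟩))).1 = _
          rw [hG₁]
          rfl }

end Transport

/-! ### Functoriality and homotopy invariance of homology -/

section Homology

variable (κ : Type v) [Field κ] (r : ℕ)

open CategoryTheory

theorem homologyMap_congr {Z Z' : Type u} [TopologicalSpace Z] [TopologicalSpace Z'] {g g' : C(Z, Z')}
    (h : g.Homotopic g') : homologyMap κ r g = homologyMap κ r g' := by
  obtain ⟨H⟩ := h
  have H' : TopCat.Homotopy (TopCat.ofHom g) (TopCat.ofHom g') := H
  exact congrArg ModuleCat.Hom.hom (H'.congr_homologyMap_singularChainComplexFunctor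
    (ModuleCat.of κ (ULift.{u} κ)) r)

theorem homologyMap_comp {Z Z' Z'' : Type u} [TopologicalSpace Z] [TopologicalSpace Z']
    [TopologicalSpace Z''] (g : C(Z, Z')) (g' : C(Z', Z'')) :
    homologyMap κ r (g'.comp g) = (homologyMap κ r g').comp (homologyMap κ r g) := by
  unfold homologyMap
  rw [TopCat.ofHom_comp, Functor.map_comp]
  rfl

theorem homologyMap_id (Z : Type u) [TopologicalSpace Z] :
    homologyMap κ r (ContinuousMap.id Z) = LinearMap.id := by
  unfold homologyMap
  rw [TopCat.ofHom_id, CategoryTheory.Functor.map_id]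
  rfl

theorem finrank_homology_eq {Z Z' : Type u} [TopologicalSpace Z] [TopologicalSpace Z']
    (e : ContinuousMap.HomotopyEquiv Z Z') :
    Module.finrank κ (homology κ r Z) = Module.finrank κ (homology κ r Z') := by
  refine LinearEquiv.finrank_eq (LinearEquiv.ofLinearMap (homologyMap κ r e.toFun)
    (homologyMap κ r e.invFun) ?_ ?_)
  · rw [← homologyMap_comp, homologyMap_congr κ r e.right_inv, homologyMap_id]
  · rw [← homologyMap_comp, homologyMap_congr κ r e.left_inv, homologyMap_id]

end Homology

/-! ### Fibres along arcs, existence of angle systems and of fibre maps -/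

section Circle

variable {X : Type u} [TopologicalSpace X] {f : X → Circle}

/-- Moves exist locally in both directions and compose, so connectedness of the interval links its
ends. Locally, straight segments serve as paths, because a ball intersected with the interval is
convex. -/
theorem moves_of_uIcc {t τ : ℝ} (h : ∀ x ∈ Set.uIcc t τ, IsFibrationAt f (Circle.exp x)) :
    Moves f (Circle.exp '' Set.uIcc t τ) (Circle.exp t) (Circle.exp τ) := by
  refine IsPreconnected.induction₂' (s := Set.uIcc t τ) Set.ordConnected_uIcc.isPreconnected
    (fun x y => Moves f (Circle.exp '' Set.uIcc t τ) (Circle.exp x) (Circle.exp y)) ?_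
    (fun _ _ _ _ _ _ => Moves.trans) Set.left_mem_uIcc Set.right_mem_uIcc
  intro x hx
  obtain ⟨U, hU, hUt⟩ := h x hx
  obtain ⟨ε, hε, hball⟩ := Metric.mem_nhds_iff.1 (Circle.exp.continuous.continuousAt.preimage_mem_nhds hU)
  have key : ∀ {a b : ℝ}, a ∈ Metric.ball x ε ∩ Set.uIcc t τ → b ∈ Metric.ball x ε ∩ Set.uIcc t τ →
      Moves f (Circle.exp '' Set.uIcc t τ) (Circle.exp a) (Circle.exp b) := by
    intro a b ha hb
    have hconv : Convex ℝ (Metric.ball x ε ∩ Set.uIcc t τ) :=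
      (convex_ball x ε).inter (convex_uIcc t τ)
    let γ : C(unitInterval, Circle) :=
      { toFun := fun s => Circle.exp (AffineMap.lineMap b a (s : ℝ))
        continuous_toFun := Circle.exp.continuous.comp
          (AffineMap.lineMap_continuous.comp continuous_subtype_val) }
    refine Moves.mono (A := Circle.exp '' (Metric.ball x ε ∩ Set.uIcc t τ))
      (hUt.moves ?_ γ (fun s => ⟨_, hconv.lineMap_mem hb ha s.2, rfl⟩) ?_ ?_)
      (Set.image_mono Set.inter_subset_right)
    · rintro _ ⟨y, hy, rfl⟩
      exact hball hy.1
    · simp [γ]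
    · simp [γ]
  have hx' : x ∈ Metric.ball x ε ∩ Set.uIcc t τ := ⟨Metric.mem_ball_self hε, hx⟩
  filter_upwards [inter_mem_nhdsWithin _ (Metric.ball_mem_nhds x hε)] with y hy
  exact ⟨key hx' ⟨hy.2, hy.1⟩, key ⟨hy.2, hy.1⟩ hx'⟩

theorem finrank_homology_fiber_eq (κ : Type v) [Field κ] (r : ℕ) {t τ : ℝ}
    (h : ∀ x ∈ Set.uIcc t τ, IsFibrationAt f (Circle.exp x)) :
    Module.finrank κ (homology κ r (f ⁻¹' {Circle.exp t})) =
      Module.finrank κ (homology κ r (f ⁻¹' {Circle.exp τ})) := by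
  refine IsPreconnected.induction₂' (s := Set.uIcc t τ) Set.ordConnected_uIcc.isPreconnected
    (fun x y => Module.finrank κ (homology κ r (f ⁻¹' {Circle.exp x})) =
      Module.finrank κ (homology κ r (f ⁻¹' {Circle.exp y}))) ?_
    (fun _ _ _ _ _ _ => Eq.trans) Set.left_mem_uIcc Set.right_mem_uIcc
  intro x hx
  obtain ⟨U, hU, hUt⟩ := h x hx
  filter_upwards [nhdsWithin_le_nhds (Circle.exp.continuous.continuousAt.preimage_mem_nhds hU)]
    with y hy
  obtain ⟨e⟩ := hUt.exists_homotopyEquiv hy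
  exact ⟨(finrank_homology_eq κ r e).symm, finrank_homology_eq κ r e⟩

theorem exists_isFiberMap (hf : IsGood f) {t s : ℝ} (hts : t ≠ s)
    (h : ∀ x ∈ Set.uIcc t s, x ≠ s → IsFibrationAt f (Circle.exp x)) {y z : Circle}
    (hy : y = Circle.exp t) (hz : z = Circle.exp s) :
    ∃ a : C(f ⁻¹' {y}, f ⁻¹' {z}), IsFiberMap f t s a := by
  subst hy hz
  obtain ⟨U, hU⟩ := hf (Circle.exp s)
  obtain ⟨ε, hε, hball⟩ := Metric.mem_nhds_iff.1
    (Circle.exp.continuous.continuousAt.preimage_mem_nhds hU.1)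
  -- `δ` places `τ` on the segment from `s` to `t`, distinct from `s` and at distance less than `ε`
  -- from it.
  obtain ⟨δ, hδ, hδ₁, hδε⟩ : ∃ δ : ℝ, 0 < δ ∧ δ ≤ 1 ∧ δ * |t - s| < ε := by
    have hpos : 0 < |t - s| := abs_pos.2 (sub_ne_zero.2 hts)
    refine ⟨min 1 (ε / 2 / |t - s|), by positivity, min_le_left _ _, ?_⟩
    calc min 1 (ε / 2 / |t - s|) * |t - s| ≤ ε / 2 / |t - s| * |t - s| := by
          gcongr; exact min_le_right _ _
      _ = ε / 2 := div_mul_cancel₀ _ hpos.ne'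
      _ < ε := by linarith
  let τ := AffineMap.lineMap s t δ
  have hτ : τ = s + δ * (t - s) := by
    simp only [τ, AffineMap.lineMap_apply, vsub_eq_sub, smul_eq_mul, vadd_eq_add]; ring
  have hτmem : τ ∈ Set.uIcc t s :=
    (convex_uIcc t s).lineMap_mem Set.right_mem_uIcc Set.left_mem_uIcc ⟨hδ.le, hδ₁⟩
  have hτs : τ ≠ s := by
    rw [hτ]
    intro h0
    have : δ * (t - s) = 0 := by linarith
    rcases mul_eq_zero.1 this with h1 | h1
    · exact hδ.ne' h1
    · exact hts (sub_eq_zero.1 h1)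
  have hsub : Circle.exp '' Set.uIcc τ s ⊆ U := by
    rintro _ ⟨x, hx, rfl⟩
    refine hball ?_
    have h1 : |s - x| ≤ |s - τ| := by
      rw [Set.uIcc_comm] at hx
      rw [abs_sub_comm s x, abs_sub_comm s τ]
      exact Set.abs_sub_left_of_mem_uIcc hx
    rw [Metric.mem_ball, dist_comm, Real.dist_eq]
    refine h1.trans_lt ?_
    rw [hτ, show s - (s + δ * (t - s)) = -(δ * (t - s)) by ring, abs_neg, abs_mul, abs_of_pos hδ]
    exact hδε
  obtain ⟨h₁, h₂, g, hg⟩ := moves_of_uIcc (f := f) (t := t) (τ := τ) (by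
    intro x hx
    refine h x (Set.uIcc_subset_uIcc_left hτmem hx) ?_
    rintro rfl
    apply hτs
    rcases le_total t τ with h' | h' <;> rcases le_total t x with h'' | h'' <;>
      simp only [Set.uIcc_of_le, Set.uIcc_of_ge, h', h'', Set.mem_Icc] at hx hτmem <;> linarith [hx.1, hx.2, hτmem.1, hτmem.2])
  have h₃ : {Circle.exp τ} ⊆ U :=
    Set.singleton_subset_iff.2 (hsub ⟨τ, Set.left_mem_uIcc, rfl⟩)
  obtain ⟨hUn, hUc, h₄, e, he⟩ := hU
  refine ⟨e.invFun.comp ((incl f h₃).comp g), rfl, rfl, τ, hτmem, hτs, U, ⟨hUn, hUc, h₄, e, he⟩,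
    hsub, h₁, h₂, h₃, h₄, g, hg, ?_⟩
  rw [← he]
  exact e.right_inv.comp (ContinuousMap.Homotopic.refl ((incl f h₃).comp g))

/-- A closed discrete subset of the compact circle is finite. -/
theorem IsTame.finite_criticalValues (hf : IsTame f) : (criticalValues f).Finite := by
  obtain ⟨S, hSc, hSd, hS⟩ := hf.fibration
  refine (hSc.isCompact.finite hSd).subset fun y hy => ?_
  by_contra h
  exact hy (hS y h)

theorem IsTame.nonempty_angleSystem (hf : IsTame f) : Nonempty (AngleSystem f) := by
  have hexp : ∀ z : Circle, ∃ x : ℝ, 0 < x ∧ x ≤ 2 * π ∧ Circle.exp x = z := by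
    intro z
    obtain ⟨x, rfl⟩ := Circle.exp_surjective z
    obtain ⟨n, ⟨h₁, h₂⟩, -⟩ := existsUnique_add_zsmul_mem_Ioc Real.two_pi_pos x 0
    refine ⟨x + n • (2 * π), h₁, by simpa using h₂, Circle.exp_eq_exp.2 ⟨n, by simp⟩⟩
  choose g hg₁ hg₂ hg₃ using hexp
  -- The angle `2π` is always listed, so that `m ≥ 1` even without critical values.
  let A : Finset ℝ := insert (2 * π) (hf.finite_criticalValues.toFinset.image g)
  have hA : ∀ x ∈ A, 0 < x ∧ x ≤ 2 * π := by
    intro x hx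
    rcases Finset.mem_insert.1 hx with rfl | hx
    · exact ⟨Real.two_pi_pos, le_rfl⟩
    · obtain ⟨z, -, rfl⟩ := Finset.mem_image.1 hx
      exact ⟨hg₁ z, hg₂ z⟩
  have hne : NeZero A.card := ⟨Finset.card_ne_zero_of_mem (Finset.mem_insert_self _ _)⟩
  let s := A.orderEmbOfFin rfl
  have hs : ∀ i, 0 < s i ∧ s i ≤ 2 * π := fun i => hA _ (A.orderEmbOfFin_mem rfl i)
  -- The predecessor of `s i`, with `0` before the first one; `t i` will be the midpoint of the two.
  let P : Fin A.card → ℝ := fun i => if h : (i : ℕ) = 0 then 0 else s ⟨i - 1, by omega⟩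
  have hP : ∀ i, 0 ≤ P i ∧ P i < s i := by
    intro i
    unfold P
    split_ifs with h
    · exact ⟨le_rfl, (hs i).1⟩
    · exact ⟨(hs _).1.le, s.strictMono (Fin.lt_def.2 (by simp only; omega))⟩
  have hP' : ∀ i j, i < j → s i ≤ P j := by
    intro i j hij
    have hij' := Fin.lt_def.1 hij
    unfold P
    rw [dif_neg (by omega)]
    exact s.monotone (Fin.le_def.2 (by simp only; omega))
  refine ⟨⟨A.card, s, fun i => (P i + s i) / 2, fun i => ?_, fun i => ?_, fun i j hij => ?_,
    fun i => (hs i).2, fun z hz => ?_⟩⟩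
  · have := hP i; linarith [hs i]
  · have := hP i; linarith
  · have := hP j; have := hP' i j hij; linarith
  · have : g z ∈ A := Finset.mem_insert_of_mem (Finset.mem_image_of_mem _ (by simpa using hz))
    obtain ⟨i, hi⟩ : g z ∈ Set.range s := by rw [Finset.range_orderEmbOfFin]; exact this
    exact ⟨i, by simp only [hi, hg₃]⟩

namespace AngleSystem

open QuiverRep

variable (S : AngleSystem f)

theorem exists_of_not_isFibrationAt {x : ℝ} (h : ¬ IsFibrationAt f (Circle.exp x)) :
    ∃ (i : Fin S.m) (n : ℤ), x = S.s i + 2 * π * n := by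
  obtain ⟨i, hi⟩ := S.critical_subset h
  obtain ⟨n, hn⟩ := Circle.exp_eq_exp.1 hi.symm
  exact ⟨i, n, by rw [hn]; ring⟩

/-- The comparison of positions shows that no lift of a critical angle lies between `t i` and `s i`
other than possibly `s i` itself. The backward case is the same, with `t (i + 1)` lifted across the
turn if necessary. -/
theorem exists_forward (hf : IsGood f) (i : Fin S.m) :
    ∃ a : C(f ⁻¹' {Circle.exp (S.t i)}, f ⁻¹' {Circle.exp (S.s i)}),
      IsFiberMap f (S.t i) (S.s i) a := by
  refine exists_isFiberMap hf (S.t_lt_s i).ne (fun x hx hxs => ?_) rfl rfl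
  by_contra hcrit
  obtain ⟨j, n, rfl⟩ := S.exists_of_not_isFibrationAt hcrit
  rw [Set.uIcc_of_le (S.t_lt_s i).le] at hx
  have e₁ : S.t i = S.t i + 2 * π * ((0 : ℤ) : ℝ) := by simp
  have e₂ : S.s i = S.s i + 2 * π * ((0 : ℤ) : ℝ) := by simp
  have h₁ := hx.1
  have h₂ := hx.2
  rw [e₁, S.t_lt_s_lift_iff] at h₁
  rw [e₂, S.s_le_s_lift_iff] at h₂
  rw [e₂, ne_eq, S.s_eq_s_lift_iff] at hxs
  omega

theorem s_lt_tNext (i : Fin S.m) : S.s i < S.tNext i := by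
  have := S.s_lt_t_lift (i := i) (j := i + 1) (n := 0) (n' := 0 + carry i) (by rw [pos_succ]; omega)
  rw [tNext_eq]
  simpa using this

theorem exists_backward (hf : IsGood f) (i : Fin S.m) :
    ∃ b : C(f ⁻¹' {Circle.exp (S.t (i + 1))}, f ⁻¹' {Circle.exp (S.s i)}),
      IsFiberMap f (S.tNext i) (S.s i) b := by
  refine exists_isFiberMap hf (S.s_lt_tNext i).ne' (fun x hx hxs => ?_)
    (Circle.exp_eq_exp.2 ⟨-carry i, by rw [tNext_eq]; push_cast; ring⟩) rfl
  by_contra hcrit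
  obtain ⟨j, n, rfl⟩ := S.exists_of_not_isFibrationAt hcrit
  rw [Set.uIcc_of_ge (S.s_lt_tNext i).le] at hx
  have e₁ : S.tNext i = S.t (i + 1) + 2 * π * ((0 + carry i : ℤ) : ℝ) := by simp [tNext_eq]
  have e₂ : S.s i = S.s i + 2 * π * ((0 : ℤ) : ℝ) := by simp
  have h₁ := hx.2
  have h₂ := hx.1
  rw [e₁, S.s_lt_t_lift_iff, pos_succ] at h₁
  rw [e₂, S.s_le_s_lift_iff] at h₂
  rw [e₂, ne_eq, S.s_eq_s_lift_iff] at hxs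
  unfold pos at *
  omega

end AngleSystem

end Circle

/-! ### Counting intersection points -/

namespace BarCode

variable (B : BarCode)

/-- The radius is `2 + (φ - s) / (s' - s)`, and `1` when `s = s'`, so the spiral avoids the origin,
which lies on every ray. -/
theorem radius_pos {φ : ℝ} (h : φ ∈ B.carrier) : 0 < B.radius φ := by
  unfold radius
  rcases B.nonempty with hlt | ⟨heq, -, -⟩
  · have h₁ : 0 < B.right - B.left := sub_pos.2 hlt
    have h₂ : 1 / (B.right - B.left) * φ + (B.right - 2 * B.left) / (B.right - B.left) + 1 =
        (φ - B.left) / (B.right - B.left) + 2 := by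
      field_simp
      ring
    rw [h₂]
    have := div_nonneg (sub_nonneg.2 h.1) h₁.le
    linarith
  · simp [heq]

theorem radius_injOn : Set.InjOn B.radius B.carrier := by
  intro φ hφ φ' hφ' h
  rcases B.nonempty with hlt | ⟨heq, -, -⟩
  · have h₁ : B.right - B.left ≠ 0 := (sub_pos.2 hlt).ne'
    unfold radius at h
    have h₂ : 1 / (B.right - B.left) * φ = 1 / (B.right - B.left) * φ' := by linarith
    exact mul_left_cancel₀ (one_div_ne_zero h₁) h₂
  · have h₁ := hφ.1; have h₂ := hφ.2.1; have h₃ := hφ'.1; have h₄ := hφ'.2.1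
    linarith

/-- Polar coordinates: positivity of the radius makes a point on the ray have angle `θ` modulo `2π`,
and injectivity of the radius makes distinct parameters give distinct points. -/
theorem rayCount_eq (θ : ℝ) : B.rayCount θ = Nat.card (B.hits θ) := by
  have hset : B.spiral ∩ ray θ =
      (fun φ : ℝ => (B.radius φ * Real.cos φ, B.radius φ * Real.sin φ)) '' B.hits θ := by
    ext z
    constructor
    · rintro ⟨⟨φ, hφ, rfl⟩, c, hc, hz⟩
      refine ⟨φ, ⟨hφ, ?_⟩, rfl⟩
      have hr := B.radius_pos hφ
      simp only [Prod.mk.injEq] at hz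
      have hsq : B.radius φ ^ 2 = c ^ 2 := by
        have e₁ : (B.radius φ * Real.cos φ) ^ 2 + (B.radius φ * Real.sin φ) ^ 2 = B.radius φ ^ 2 := by
          linear_combination B.radius φ ^ 2 * Real.sin_sq_add_cos_sq φ
        have e₂ : (c * Real.cos θ) ^ 2 + (c * Real.sin θ) ^ 2 = c ^ 2 := by
          linear_combination c ^ 2 * Real.sin_sq_add_cos_sq θ
        rw [← e₁, ← e₂, hz.1, hz.2]
      have hrc : B.radius φ = c := (pow_left_inj₀ hr.le hc two_ne_zero).1 hsq
      rw [← hrc] at hz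
      have hang := Real.Angle.cos_sin_inj (mul_left_cancel₀ hr.ne' hz.1)
        (mul_left_cancel₀ hr.ne' hz.2)
      obtain ⟨n, hn⟩ := Real.Angle.angle_eq_iff_two_pi_dvd_sub.1 hang
      exact ⟨n, by linarith⟩
    · rintro ⟨φ, ⟨hφ, n, hn⟩, rfl⟩
      refine ⟨⟨φ, hφ, rfl⟩, B.radius φ, (B.radius_pos hφ).le, ?_⟩
      have hang : (φ : Real.Angle) = θ :=
        Real.Angle.angle_eq_iff_two_pi_dvd_sub.2 ⟨n, by linarith⟩
      have hcos : Real.cos φ = Real.cos θ := by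
        rw [← Real.Angle.cos_coe φ, hang, Real.Angle.cos_coe]
      have hsin : Real.sin φ = Real.sin θ := by
        rw [← Real.Angle.sin_coe φ, hang, Real.Angle.sin_coe]
      simp only [hcos, hsin]
  unfold rayCount
  rw [hset, Set.InjOn.ncard_image, ← Nat.card_coe_set_eq]
  intro φ hφ φ' hφ' h
  simp only [Prod.mk.injEq] at h
  refine B.radius_injOn hφ.1 hφ'.1
    ((pow_left_inj₀ (B.radius_pos hφ.1).le (B.radius_pos hφ'.1).le two_ne_zero).1 ?_)
  have e₁ : ∀ ψ, (B.radius ψ * Real.cos ψ) ^ 2 + (B.radius ψ * Real.sin ψ) ^ 2 =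
      B.radius ψ ^ 2 := fun ψ => by
    linear_combination B.radius ψ ^ 2 * Real.sin_sq_add_cos_sq ψ
  rw [← e₁, ← e₁, h.1, h.2]

theorem hits_add_turns (x : ℝ) (n : ℤ) : B.hits (x + 2 * π * n) = B.hits x := by
  ext φ
  refine and_congr_right fun _ => ⟨fun ⟨k, hk⟩ => ⟨n + k, ?_⟩, fun ⟨k, hk⟩ => ⟨k - n, ?_⟩⟩
  · rw [hk]; push_cast; ring
  · rw [hk]; push_cast; ring

/-- Two rays meet the spiral equally often if translations by whole turns of the two angles belong
to the bar code at the same time. -/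
theorem card_hits_congr {x x' : ℝ}
    (h : ∀ n : ℤ, x + 2 * π * n ∈ B.carrier ↔ x' + 2 * π * n ∈ B.carrier) :
    Nat.card (B.hits x) = Nat.card (B.hits x') := by
  have key : ∀ {a b : ℝ}, (∀ n : ℤ, a + 2 * π * n ∈ B.carrier → b + 2 * π * n ∈ B.carrier) →
      ∀ φ ∈ B.hits a, φ + (b - a) ∈ B.hits b := by
    rintro a b hab _ ⟨hφ, n, rfl⟩
    have e : a + 2 * π * n + (b - a) = b + 2 * π * n := by ring
    rw [e]
    exact ⟨hab n hφ, n, rfl⟩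
  exact Nat.card_congr
    { toFun := fun φ => ⟨φ + (x' - x), key (fun n => (h n).1) φ φ.2⟩
      invFun := fun φ => ⟨φ + (x - x'), key (fun n => (h n).2) φ φ.2⟩
      left_inv := fun φ => Subtype.ext (by simp only; ring)
      right_inv := fun φ => Subtype.ext (by simp only; ring) }

end BarCode

/-! ### Constancy over gaps and the dimension formula -/

namespace AngleSystem

open QuiverRep Module

variable {X : Type u} [TopologicalSpace X] {f : X → Circle} (S : AngleSystem f)

/-- Every angle is a lift of a critical angle or lies between the lifts of two consecutive ones. -/
theorem exists_gap (θ : ℝ) : ∃ (i : Fin S.m) (n : ℤ), θ = S.s i + 2 * π * n ∨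
    (S.s i + 2 * π * n < θ ∧ θ < S.s (i + 1) + 2 * π * (n + carry i : ℤ)) := by
  let P : ℤ → Prop := fun k => ∃ (i : Fin S.m) (n : ℤ), pos i n = 2 * k ∧ S.s i + 2 * π * n ≤ θ
  have hpi := Real.two_pi_pos
  have hbdd : ∃ b : ℤ, ∀ k, P k → k ≤ b := by
    obtain ⟨N, hN⟩ := exists_int_gt ((θ - S.s 0) / (2 * π))
    rw [div_lt_iff₀ hpi] at hN
    refine ⟨(0 : Fin S.m).val + S.m * N, ?_⟩
    rintro k ⟨i, n, hpos, hle⟩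
    have h : S.s i + 2 * π * n ≤ S.s 0 + 2 * π * N := by linarith
    rw [S.s_le_s_lift_iff] at h
    unfold pos at *
    omega
  have hne : ∃ k, P k := by
    obtain ⟨N, hN⟩ := exists_int_lt ((θ - S.s 0) / (2 * π))
    rw [lt_div_iff₀ hpi] at hN
    exact ⟨_, 0, N, rfl, by linarith⟩
  -- The last lift of a critical angle not exceeding `θ`; by maximality the next lift exceeds `θ`.
  obtain ⟨k, ⟨i, n, hpos, hle⟩, hmax⟩ := Int.exists_greatest_of_bdd hbdd hne
  refine ⟨i, n, hle.eq_or_lt.imp Eq.symm fun h => ⟨h, ?_⟩⟩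
  by_contra! hle'
  have := hmax (k + 1) ⟨i + 1, n + carry i, by rw [pos_succ]; omega, hle'⟩
  omega

/-- The interval between two consecutive lifts of critical angles. -/
def gap (i : Fin S.m) (n : ℤ) : Set ℝ :=
  Set.Ioo (S.s i + 2 * π * n) (S.s (i + 1) + 2 * π * (n + carry i : ℤ))

theorem t_mem_gap (i : Fin S.m) (n : ℤ) : S.t (i + 1) + 2 * π * (n + carry i : ℤ) ∈ S.gap i n :=
  ⟨S.s_lt_t_lift (by rw [pos_succ]; omega), S.t_lt_s_lift le_rfl⟩

theorem lift_lt_or_gt {i j : Fin S.m} {n k : ℤ} :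
    (∀ x ∈ S.gap i n, S.s j + 2 * π * k < x) ∨ ∀ x ∈ S.gap i n, x < S.s j + 2 * π * k := by
  rcases le_or_gt (pos j k) (pos i n) with h | h
  · exact Or.inl fun x hx => (S.s_le_s_lift_iff.2 h).trans_lt hx.1
  · refine Or.inr fun x hx => hx.2.trans_le (S.s_le_s_lift_iff.2 ?_)
    rw [pos_succ]
    unfold pos at *
    omega

theorem finrank_homology_eq_of_mem_gap (κ : Type v) [Field κ] (r : ℕ) {i : Fin S.m} {n : ℤ}
    {x x' : ℝ} (hx : x ∈ S.gap i n) (hx' : x' ∈ S.gap i n) :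
    finrank κ (homology κ r (f ⁻¹' {Circle.exp x})) =
      finrank κ (homology κ r (f ⁻¹' {Circle.exp x'})) := by
  refine finrank_homology_fiber_eq κ r fun y hy => ?_
  by_contra hcrit
  obtain ⟨j, k, rfl⟩ := S.exists_of_not_isFibrationAt hcrit
  have hmem : S.s j + 2 * π * k ∈ S.gap i n := Set.ordConnected_Ioo.uIcc_subset hx hx' hy
  rcases S.lift_lt_or_gt (i := i) (j := j) (n := n) (k := k) with h | h <;>
    exact lt_irrefl _ (h _ hmem)

/-- The ends of `B`, shifted by whole turns, are again lifts of critical angles. So each translate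
of the gap lies entirely inside or entirely outside `B`, whether its ends are open or closed. -/
theorem card_hits_eq_of_mem_gap {B : BarCode} (hB : S.EndsAt B) {i : Fin S.m} {n : ℤ}
    {x x' : ℝ} (hx : x ∈ S.gap i n) (hx' : x' ∈ S.gap i n) :
    Nat.card (B.hits x) = Nat.card (B.hits x') := by
  obtain ⟨j, j', k, hl, hr⟩ := hB
  have key : ∀ {a b : ℝ}, a ∈ S.gap i n → b ∈ S.gap i n → ∀ l : ℤ,
      a + 2 * π * l ∈ B.carrier → b + 2 * π * l ∈ B.carrier := by
    rintro a b ha hb l ⟨h₁, h₂, -, -⟩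
    have e₁ : B.left - 2 * π * l = S.s j + 2 * π * (-l : ℤ) := by rw [hl]; push_cast; ring
    have e₂ : B.right - 2 * π * l = S.s j' + 2 * π * (k - l : ℤ) := by rw [hr]; push_cast; ring
    have hlb : B.left < b + 2 * π * l := by
      rcases S.lift_lt_or_gt (i := i) (j := j) (n := n) (k := -l) with h | h
      · linarith [h b hb]
      · linarith [h a ha]
    have hbr : b + 2 * π * l < B.right := by
      rcases S.lift_lt_or_gt (i := i) (j := j') (n := n) (k := k - l) with h | h
      · linarith [h a ha]
      · linarith [h b hb]
    exact ⟨hlb.le, hbr.le, fun h => absurd h hlb.ne', fun h => absurd h hbr.ne⟩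
  exact B.card_hits_congr fun l => ⟨key hx hx' l, key hx' hx l⟩

theorem finrank_directSum {κ : Type v} [Field κ] {p q : ℕ} (B : Fin p → BarCode)
    (J : Fin q → JordanCell κ) (i : Fin S.m) :
    (finrank (AlgebraicClosure κ) ((directSum (ι := Fin p ⊕ Fin q) (Sum.elim
      (fun l => S.barRep (AlgebraicClosure κ) (B l)) fun l => (J l).rep S.m)).V i) =
        ∑ l, Nat.card ((B l).hits (S.t i)) + ∑ l, (J l).size) ∧
    finrank (AlgebraicClosure κ) ((directSum (ι := Fin p ⊕ Fin q) (Sum.elim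
      (fun l => S.barRep (AlgebraicClosure κ) (B l)) fun l => (J l).rep S.m)).W i) =
        ∑ l, Nat.card ((B l).hits (S.s i)) + ∑ l, (J l).size := by
  set F : Fin p ⊕ Fin q → QuiverRep (AlgebraicClosure κ) S.m := Sum.elim
      (fun l => S.barRep (AlgebraicClosure κ) (B l)) fun l => (J l).rep S.m
  have hcard : ∀ (l : Fin p) (x : ℝ), finrank (AlgebraicClosure κ)
      ((B l).hits x →₀ AlgebraicClosure κ) = Nat.card ((B l).hits x) := fun l x => by
    have := Fintype.ofFinite ((B l).hits x)
    rw [finrank_finsupp_self, Nat.card_eq_fintype_card]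
  have hfinV : ∀ j, Module.Finite (AlgebraicClosure κ) ((F j).V i) := by
    rintro (l | l)
    · exact inferInstanceAs (Module.Finite _ ((B l).hits (S.t i) →₀ AlgebraicClosure κ))
    · exact inferInstanceAs (Module.Finite _ (Fin (J l).size → AlgebraicClosure κ))
  have hfinW : ∀ j, Module.Finite (AlgebraicClosure κ) ((F j).W i) := by
    rintro (l | l)
    · exact inferInstanceAs (Module.Finite _ ((B l).hits (S.s i) →₀ AlgebraicClosure κ))
    · exact inferInstanceAs (Module.Finite _ (Fin (J l).size → AlgebraicClosure κ))
  constructor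
  · change finrank (AlgebraicClosure κ) (∀ j, (F j).V i) = _
    rw [finrank_pi_fintype, Fintype.sum_sum_type]
    congr 1
    · exact Finset.sum_congr rfl fun l _ => hcard l _
    · exact Finset.sum_congr rfl fun l _ => finrank_fin_fun _
  · change finrank (AlgebraicClosure κ) (∀ j, (F j).W i) = _
    rw [finrank_pi_fintype, Fintype.sum_sum_type]
    congr 1
    · exact Finset.sum_congr rfl fun l _ => hcard l _
    · exact Finset.sum_congr rfl fun l _ => finrank_fin_fun _

theorem IsInvariants.finrank_vertex {S : AngleSystem f} {κ : Type v} [Field κ] {r : ℕ} {p q : ℕ}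
    {B : Fin p → BarCode} {J : Fin q → JordanCell κ} (h : S.IsInvariants κ r B J) (i : Fin S.m) :
    (finrank κ (homology κ r (f ⁻¹' {Circle.exp (S.t i)})) =
      ∑ l, Nat.card ((B l).hits (S.t i)) + ∑ l, (J l).size) ∧
    finrank κ (homology κ r (f ⁻¹' {Circle.exp (S.s i)})) =
      ∑ l, Nat.card ((B l).hits (S.s i)) + ∑ l, (J l).size := by
  obtain ⟨-, a, b, -, -, eV, eW, -, -⟩ := h
  have hV := (eV i).finrank_eq
  have hW := (eW i).finrank_eq
  rw [(S.finrank_directSum B J i).1] at hV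
  rw [(S.finrank_directSum B J i).2] at hW
  exact ⟨finrank_baseChange.symm.trans hV, finrank_baseChange.symm.trans hW⟩

theorem exp_add_turns (x : ℝ) (n : ℤ) : Circle.exp (x + 2 * π * n) = Circle.exp x :=
  Circle.exp_eq_exp.2 ⟨n, by ring⟩

/-- The dimension of the homology of every fibre is read off from the bar codes and the Jordan
cells. -/
theorem IsInvariants.finrank_homology {S : AngleSystem f} {κ : Type v} [Field κ] {r : ℕ} {p q : ℕ}
    {B : Fin p → BarCode} {J : Fin q → JordanCell κ} (h : S.IsInvariants κ r B J) (θ : ℝ) :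
    finrank κ (homology κ r (f ⁻¹' {Circle.exp θ})) = ∑ l, (B l).rayCount θ + ∑ l, (J l).size := by
  simp only [BarCode.rayCount_eq]
  obtain ⟨i, n, rfl | hgap⟩ := S.exists_gap θ
  · simp only [BarCode.hits_add_turns]
    rw [exp_add_turns]
    exact (h.finrank_vertex i).2
  -- Inside a gap both sides of the formula are moved to the lift of `t (i + 1)` in it, where the
  -- vertex formula applies.
  · have ht := S.t_mem_gap i n
    rw [S.finrank_homology_eq_of_mem_gap κ r hgap ht, exp_add_turns,
      (h.finrank_vertex (i + 1)).1]
    congr 1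
    refine Finset.sum_congr rfl fun l _ => ?_
    rw [S.card_hits_eq_of_mem_gap (h.1 l) hgap ht, BarCode.hits_add_turns]

theorem exists_isInvariants (hf : IsGood f) (κ : Type v) [Field κ] (r : ℕ)
    (hfin : ∀ θ : ℝ, Module.Finite κ (homology κ r (f ⁻¹' {Circle.exp θ}))) :
    ∃ (p q : ℕ) (B : Fin p → BarCode) (J : Fin q → JordanCell κ), S.IsInvariants κ r B J := by
  choose a ha using S.exists_forward hf
  choose b hb using S.exists_backward hf
  have hV : ∀ i, Module.Finite κ ((S.homologyRep κ r a b).V i) := fun i => hfin _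
  have hW : ∀ i, Module.Finite κ ((S.homologyRep κ r a b).W i) := fun i => hfin _
  obtain ⟨p, q, B, J, hB, hiso⟩ := S.exists_isIsomorphic_directSum _
    ((S.homologyRep κ r a b).baseChange (AlgebraicClosure κ))
    ⟨fun i => inferInstanceAs (Module.Finite _
      (AlgebraicClosure κ ⊗[κ] (S.homologyRep κ r a b).V i)),
     fun i => inferInstanceAs (Module.Finite _
      (AlgebraicClosure κ ⊗[κ] (S.homologyRep κ r a b).W i))⟩ rfl
  exact ⟨p, q, B, J, hB, a, b, ha, hb, hiso⟩

end AngleSystem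

end CircleMap

end

theorem theorem1 {X : Type*} [TopologicalSpace X] [CompactSpace X]
    (κ : Type*) [Field κ] (f : X → Circle) (hf : CircleMap.IsTame f) (r : ℕ)
    (hfin : ∀ θ : ℝ, Module.Finite κ (CircleMap.homology κ r (f ⁻¹' {Circle.exp θ}))) :
    Nonempty (CircleMap.AngleSystem f) ∧
    ∀ S : CircleMap.AngleSystem f,
      (∃ (p q : ℕ) (B : Fin p → CircleMap.BarCode) (J : Fin q → CircleMap.JordanCell κ),
        S.IsInvariants κ r B J) ∧
      ∀ (p q : ℕ) (B : Fin p → CircleMap.BarCode) (J : Fin q → CircleMap.JordanCell κ),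
        S.IsInvariants κ r B J →
        ∀ θ : ℝ, Module.finrank κ (CircleMap.homology κ r (f ⁻¹' {Circle.exp θ})) =
          ∑ l, (B l).rayCount θ + ∑ l, (J l).size := by
  refine ⟨hf.nonempty_angleSystem, fun S => ⟨S.exists_isInvariants hf.good κ r hfin, ?_⟩⟩
  intro p q B J h θ
  exact h.finrank_homology θ
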